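/- Let $\mathcal X$ be an infinite-dimensional separable real Hilbert space. Let $\mathcal C_0$ be a bounded, self-adjoint, positive-definite operator on $\mathcal X$ with orthonormal eigenbasis $(\phi_k)$, $\mathcal C_0\phi_k=\kappa_k\phi_k$, let $\mathcal C_1$ be a bounded, self-adjoint, positive-definite operator (not necessarily trace class), and let $\mathcal A$ be a self-adjoint, positive-definite, possibly unbounded operator with bounded inverse $\mathcal A^{-1}:\mathcal X\to\mathcal X$. For $t\in\mathbb R$ let $X^t$ be the Hilbert scale of $\mathcal C_0$, with norm $\|u\|_t=\|\mathcal C_0^{-t/2}u\|=\big(\sum_k\kappa_k^{-t}\langle\phi_k,u\rangle^2\big)^{1/2}$. Assume that there are $s_0\in[0,1)$, $\beta,\ell\ge 0$ and constants $c_1,\dots,c_4>0$ such that, with $\Delta=2\ell-\beta+1$, 1. $\mathcal C_0^s$ is trace class for all $s>s_0$; 2. $\Delta>2s_0$; 3. $\|\mathcal C_1^{-1/2}\mathcal A^{-1}u\|\asymp\|\mathcal C_0^{\ell-\beta/2}u\|$ for all $u\in X^{\beta-2\ell}$; 4. $\|\mathcal C_0^{-\rho/2}\mathcal C_1^{1/2}u\|\le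 c_1\|\mathcal C_0^{(\beta-\rho)/2}u\|$ for all $u\in X^{\rho-\beta}$ and $\rho\in[\lceil\beta-s_0-1\rceil,\beta-s_0)$; 5. $\|\mathcal C_0^{s/2}\mathcal C_1^{-1/2}u\|\le c_2\|\mathcal C_0^{(s-\beta)/2}u\|$ for all $u\in X^{\beta-s}$ and $s\in(s_0,1]$; 6. $\|\mathcal C_0^{-s/2}\mathcal C_1^{-1/2}\mathcal A^{-1}u\|\le c_3\|\mathcal C_0^{(2\ell-\beta-s)/2}u\|$ for all $u\in X^{s+\beta-2\ell}$ and $s\in(s_0,1]$; 7. $\|\mathcal C_0^{\eta/2}\mathcal A^{-1}\mathcal C_1^{-1}u\|\le c_4\|\mathcal C_0^{\eta/2+\ell-\beta}u\|$ for all $u\in X^{2\beta-2\ell-\eta}$ and $\eta\in[\beta-2\ell,1]$. (It suffices that these inequalities hold for those $u$ in the stated space which lie in $\mathcal X$ and, in 5 and 7, in the domain of $\mathcal C_1^{-1/2}$ and $\mathcal C_1^{-1}$ respectively; in 3, $\mathcal A^{-1}u$ is required to lie in the domain of $\mathcal C_1^{-1/2}$.) For $n\in\mathbb N$ and $\tau>0$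 consider the Bayesian model in which $u\sim\mathcal N(0,\tau^2\mathcal C_0)$ and, given $u$, the data are $y=\mathcal A^{-1}u+n^{-1/2}\xi$ with $\xi\sim\mathcal N(0,\mathcal C_1)$ independent of $u$ (the noise, hence $y$, is a generalized random element given by its coordinates in the basis $(\phi_k)$). Let $\mu^{y}_{n,\tau}$ be the posterior, that is, the conditional law of $u$ given $y$. Let $u^\dagger\in X^\gamma$ with $\gamma\ge1$, and let $\varepsilon>0$. Then, for the choices of $\tau=\tau(n)$ and $\varepsilon_n$ below, $$\mathbb E^{y^\dagger}\,\mu^{y^\dagger}_{n,\tau(n)}\{u:\|u-u^\dagger\|\ge M_n\varepsilon_n\}\to0\quad(n\to\infty)\qquad\text{for every sequence }M_n\to\infty,$$ where $y^\dagger=\mathcal A^{-1}u^\dagger+n^{-1/2}\xi\sim\mathcal N(\mathcal A^{-1}u^\dagger,\tfrac1n\mathcal C_1)$: (i) if $\gamma\in[1,\Delta+1]$, for $\tau(n)=n^{-\frac{\gamma-1+s_0+\varepsilon}{2(\Delta+\gamma-1+s_0+\varepsilon)}}$ and $$\varepsilon_n=\begin{cases}n^{-\frac{\gamma}{2(\Delta+\gamma-1+s_0+\varepsilon)}}&\text{if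 }\beta-2\ell\le0,\\ n^{-\frac{\Delta+\gamma-1}{2(\Delta+\gamma-1+s_0+\varepsilon)}}&\text{otherwise;}\end{cases}$$ (ii) if $\gamma>\Delta+1$, for $\tau(n)=n^{-\frac{\Delta+s_0+\varepsilon}{2(2\Delta+s_0+\varepsilon)}}$ and $$\varepsilon_n=\begin{cases}n^{-\frac{\Delta+1}{2(2\Delta+s_0+\varepsilon)}}&\text{if }\beta-2\ell\le0,\\ n^{-\frac{\Delta}{2\Delta+s_0+\varepsilon}}&\text{otherwise.}\end{cases}$$ In particular, if $\beta\le2\ell$, then $\varepsilon_n=n^{-\frac{\gamma\wedge(\Delta+1)}{2(\Delta+\gamma\wedge(\Delta+1)-1+s_0+\varepsilon)}}$ in both cases. -/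

import Mathlib

open MeasureTheory ProbabilityTheory Filter Topology
open scoped RealInnerProductSpace

namespace LinInv

noncomputable section

variable {X : Type*} [NormedAddCommGroup X] [InnerProductSpace ℝ X]

/-! ### Operators -/

/-- A bounded, self-adjoint, positive-definite operator on the real Hilbert space `X`. -/
structure IsPosDef [CompleteSpace X] (T : X →L[ℝ] X) : Prop where
  isSelfAdjoint : IsSelfAdjoint T
  pos : ∀ u : X, u ≠ 0 → 0 < ⟪T u, u⟫

/-- `R` is the positive square root of `T` (which determines `R` uniquely). -/
structure IsPosSqrt [CompleteSpace X] (R T : X →L[ℝ] X) : Prop where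
  isPositive : R.IsPositive
  comp_self : R ∘L R = T

/-- `A` is a (possibly unbounded) self-adjoint, positive-definite operator and the bounded
operator `K` is its inverse. -/
structure IsPosDefWithInverse [CompleteSpace X] (A : X →ₗ.[ℝ] X) (K : X →L[ℝ] X) : Prop where
  isSelfAdjoint : IsSelfAdjoint A
  pos : ∀ u : A.domain, (u : X) ≠ 0 → 0 < ⟪A u, (u : X)⟫
  right_inv : ∀ x : X, ∃ h : K x ∈ A.domain, A ⟨K x, h⟩ = x
  left_inv : ∀ u : A.domain, K (A u) = u

/-! ### The Hilbert scale of the prior covariance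

`φ` is an orthonormal eigenbasis of `C₀` with eigenvalues `κ k > 0`, so that
`‖C₀^{-t/2} u‖² = ∑ₖ κₖ^{-t} ⟨φₖ, u⟩²`. -/

/-- `u ∈ X^t`, for an element `u` of `X`. For `t ≥ 0` this is the whole of the space `X^t`. For
`t < 0` it holds for all `u : X`, and `X` is a dense subspace of `X^t`. -/
def MemScale (φ : HilbertBasis ℕ ℝ X) (κ : ℕ → ℝ) (t : ℝ) (u : X) : Prop :=
  Summable fun k => κ k ^ (-t) * ⟪φ k, u⟫ ^ 2

/-- The norm `‖u‖_t = ‖C₀^{-t/2} u‖` of the space `X^t`. -/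
def scaleNorm (φ : HilbertBasis ℕ ℝ X) (κ : ℕ → ℝ) (t : ℝ) (u : X) : ℝ :=
  √(∑' k, κ k ^ (-t) * ⟪φ k, u⟫ ^ 2)

/-- The standing assumptions relating the prior covariance `C₀` (through its eigenpairs
`κ k, φ k`), the noise covariance `C₁` with square root `R = C₁^{1/2}`, and the forward operator
`K = A⁻¹`.

The inequalities are required for arguments `u` in `X` (and in the domain of `C₁^{-1/2}` or `C₁⁻¹`
where that operator is applied first; the value is then written as the preimage `w` of `u` under
`R` or `C₁`). For arguments in a space of negative order they are understood by continuous
extension. -/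
structure ScaleAssumptions (φ : HilbertBasis ℕ ℝ X) (κ : ℕ → ℝ) (C₁ R K : X →L[ℝ] X)
    (s₀ β ℓ : ℝ) : Prop where
  s₀_nonneg : 0 ≤ s₀
  s₀_lt_one : s₀ < 1
  β_nonneg : 0 ≤ β
  ℓ_nonneg : 0 ≤ ℓ
  /-- `C₀^s` is trace class for all `s > s₀`. -/
  traceClass : ∀ s : ℝ, s₀ < s → Summable fun k => κ k ^ s
  /-- `Δ > 2 s₀`, where `Δ = 2ℓ - β + 1`. -/
  illPosed : 2 * s₀ < 2 * ℓ - β + 1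
  /-- `‖C₁^{-1/2} A⁻¹ u‖ ≍ ‖C₀^{ℓ-β/2} u‖` on `X^{β-2ℓ}`; in particular `A⁻¹ u` lies in the domain
  of `C₁^{-1/2}`. -/
  equiv_forward : ∃ c > 0, ∃ c' > 0, ∀ u : X, MemScale φ κ (β - 2 * ℓ) u →
    ∃ w : X, R w = K u ∧ c * ‖w‖ ≤ scaleNorm φ κ (β - 2 * ℓ) u ∧
      scaleNorm φ κ (β - 2 * ℓ) u ≤ c' * ‖w‖
  /-- `‖C₀^{-ρ/2} C₁^{1/2} u‖ ≤ c₁ ‖C₀^{(β-ρ)/2} u‖` on `X^{ρ-β}`. -/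
  sqrt_bound : ∃ c₁ > 0, ∀ ρ : ℝ, (⌈β - s₀ - 1⌉ : ℝ) ≤ ρ → ρ < β - s₀ →
    ∀ u : X, MemScale φ κ (ρ - β) u →
      MemScale φ κ ρ (R u) ∧ scaleNorm φ κ ρ (R u) ≤ c₁ * scaleNorm φ κ (ρ - β) u
  /-- `‖C₀^{s/2} C₁^{-1/2} u‖ ≤ c₂ ‖C₀^{(s-β)/2} u‖` on `X^{β-s}`, with `u = C₁^{1/2} w`. -/
  invSqrt_bound : ∃ c₂ > 0, ∀ s : ℝ, s₀ < s → s ≤ 1 →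
    ∀ w : X, MemScale φ κ (β - s) (R w) →
      MemScale φ κ (-s) w ∧ scaleNorm φ κ (-s) w ≤ c₂ * scaleNorm φ κ (β - s) (R w)
  /-- `‖C₀^{-s/2} C₁^{-1/2} A⁻¹ u‖ ≤ c₃ ‖C₀^{(2ℓ-β-s)/2} u‖` on `X^{s+β-2ℓ}`, with
  `w = C₁^{-1/2} A⁻¹ u`. -/
  forward_bound : ∃ c₃ > 0, ∀ s : ℝ, s₀ < s → s ≤ 1 →
    ∀ u w : X, MemScale φ κ (s + β - 2 * ℓ) u → R w = K u →
      MemScale φ κ s w ∧ scaleNorm φ κ s w ≤ c₃ * scaleNorm φ κ (s + β - 2 * ℓ) u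
  /-- `‖C₀^{η/2} A⁻¹ C₁⁻¹ u‖ ≤ c₄ ‖C₀^{η/2+ℓ-β} u‖` on `X^{2β-2ℓ-η}`, with `u = C₁ w`. -/
  precision_bound : ∃ c₄ > 0, ∀ η : ℝ, β - 2 * ℓ ≤ η → η ≤ 1 →
    ∀ w : X, MemScale φ κ (2 * β - 2 * ℓ - η) (C₁ w) →
      MemScale φ κ (-η) (K w) ∧
        scaleNorm φ κ (-η) (K w) ≤ c₄ * scaleNorm φ κ (2 * β - 2 * ℓ - η) (C₁ w)

/-! ### Gaussian laws -/

variable [MeasurableSpace X] [BorelSpace X]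

/-- `μ = N(0, C)` on the Hilbert space `X`. -/
structure IsCenteredGaussian [CompleteSpace X] (μ : Measure X) (C : X →L[ℝ] X) : Prop where
  isGaussian : IsGaussian μ
  mean : ∫ u, u ∂μ = 0
  cov : ∀ u v : X, covarianceBilin μ u v = ⟪C u, v⟫

/-- `P` is the law `N(0, C)`, where `C` is bounded but not necessarily trace class (`C = 1` is
white noise). A draw `ξ` need not belong to `X`, and is given by the sequence of its coordinates
`ξ k = ⟨φ k, ξ⟩` in the orthonormal basis `φ`: these are jointly Gaussian and centered, with
covariances `⟨C φ j, φ k⟩`. -/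
structure IsCenteredGaussianSeq (P : Measure (ℕ → ℝ)) (φ : HilbertBasis ℕ ℝ X)
    (C : X →L[ℝ] X) : Prop where
  isGaussian : IsGaussianProcess (fun (k : ℕ) (x : ℕ → ℝ) => x k) P
  mean : ∀ k, ∫ x, x k ∂P = 0
  cov : ∀ j k, cov[fun x => x j, fun x => x k; P] = ⟪C (φ j), φ k⟫

/-! ### The Bayesian inverse problem -/

/-- The coordinates of the data `y = K u + n^{-1/2} ξ`. -/
def dataOf (φ : HilbertBasis ℕ ℝ X) (K : X →L[ℝ] X) (n : ℕ) (p : X × (ℕ → ℝ)) : ℕ → ℝ :=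
  fun k => ⟪φ k, K p.1⟫ + (√(n : ℝ))⁻¹ * p.2 k

theorem measurable_dataOf (φ : HilbertBasis ℕ ℝ X) (K : X →L[ℝ] X) (n : ℕ) :
    Measurable (dataOf φ K n) := by
  refine measurable_pi_lambda _ fun k => ?_
  have h1 : Measurable fun u : X => ⟪φ k, K u⟫ :=
    (Continuous.inner continuous_const K.continuous).measurable
  have h2 : Measurable fun x : ℕ → ℝ => x k := measurable_pi_apply k
  exact (h1.comp measurable_fst).add ((h2.comp measurable_snd).const_mul _)

/-- The likelihood: the law `N(K u, n⁻¹ C₁)` of the data given `u`, where `P` is the law `N(0, C₁)`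
of the noise. -/
def likelihood (φ : HilbertBasis ℕ ℝ X) (K : X →L[ℝ] X) (P : Measure (ℕ → ℝ)) (n : ℕ) :
    Kernel X (ℕ → ℝ) :=
  (Kernel.id ×ₖ Kernel.const X P).map (dataOf φ K n)

instance (φ : HilbertBasis ℕ ℝ X) (K : X →L[ℝ] X) (P : Measure (ℕ → ℝ)) [IsProbabilityMeasure P]
    (n : ℕ) : IsMarkovKernel (likelihood φ K P n) :=
  Kernel.IsMarkovKernel.map _ (measurable_dataOf φ K n)

theorem likelihood_apply (φ : HilbertBasis ℕ ℝ X) (K : X →L[ℝ] X) (P : Measure (ℕ → ℝ))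
    [IsProbabilityMeasure P] (n : ℕ) (u : X) :
    likelihood φ K P n u = P.map fun x => dataOf φ K n (u, x) := by
  rw [likelihood, Kernel.map_apply _ (measurable_dataOf φ K n), Kernel.prod_apply,
    Kernel.id_apply, Kernel.const_apply, Measure.dirac_prod,
    Measure.map_map (measurable_dataOf φ K n) (by fun_prop)]
  rfl

/-- The prior `N(0, τ² C₀)`, where `μ` is the law `N(0, C₀)`. -/
def prior (μ : Measure X) (τ : ℝ) : Measure X := μ.map fun u => τ • u

instance (μ : Measure X) [IsProbabilityMeasure μ] (τ : ℝ) : IsFiniteMeasure (prior μ τ) := by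
  unfold prior; infer_instance

/-- The posterior: the conditional law of `u` given the data `y = K u + n^{-1/2} ξ`, for the prior
`N(0, τ² C₀)` and independent noise `ξ ∼ N(0, C₁)`. -/
def posteriorLaw [CompleteSpace X] [SecondCountableTopology X] (φ : HilbertBasis ℕ ℝ X)
    (K : X →L[ℝ] X) (μ : Measure X) [IsProbabilityMeasure μ] (P : Measure (ℕ → ℝ))
    [IsProbabilityMeasure P] (n : ℕ) (τ : ℝ) : Kernel (ℕ → ℝ) X :=
  posterior (likelihood φ K P n) (prior μ τ)

/-- Contraction of the posterior to the point mass at `u'` at rate `r`, for the prior scaling `τ`: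
for every `Mₙ → ∞`, the expectation of the posterior mass of `{u : ‖u - u'‖ ≥ Mₙ rₙ}`, under
data with law `N(K u', n⁻¹ C₁)`, tends to `0`. -/
def PosteriorContracts [CompleteSpace X] [SecondCountableTopology X] (φ : HilbertBasis ℕ ℝ X)
    (K : X →L[ℝ] X) (μ : Measure X) [IsProbabilityMeasure μ] (P : Measure (ℕ → ℝ))
    [IsProbabilityMeasure P] (u' : X) (τ r : ℕ → ℝ) : Prop :=
  ∀ M : ℕ → ℝ, Tendsto M atTop atTop →
    Tendsto (fun n : ℕ => ∫⁻ y, posteriorLaw φ K μ P n (τ n) y {u : X | M n * r n ≤ ‖u - u'‖}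
      ∂(likelihood φ K P n u')) atTop (𝓝 0)

end

end LinInv

/-!
Let `D = C₀^{1/2}` and let `M = C₁^{-1/2} K D`, which is bounded because `K` maps the range of `D`
into that of `R = C₁^{1/2}`. By joint Gaussianity, each coordinate of `u` is, given `y`, normal with
a mean that is linear in `y` and a variance that does not depend on `y`; both are expressed through
`(1 + nτ² M*M)⁻¹`. As `M*M` is bounded below by a multiple of `C₀^Δ`, this bounds the mean square
error of the posterior, as the sum of a variance and a squared bias, by powers of `τ` and of `nτ²`.
The scaling `τ(n)` balances the two, and Markov's inequality turns the bound into contraction.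
-/

namespace LinInv

/-! ### Gaussian families -/

section GaussianFamily

theorem lintegral_add_const_sq_gaussianReal (v : NNReal) (b : ℝ) :
    ∫⁻ x, ENNReal.ofReal ((x + b) ^ 2) ∂(gaussianReal 0 v) = ENNReal.ofReal (v + b ^ 2) := by
  have hid : MemLp (fun x : ℝ => x) 2 (gaussianReal 0 v) := memLp_id_gaussianReal 2
  have hshift : MemLp (fun x => x + b) 2 (gaussianReal 0 v) := hid.add (memLp_const b)
  have hmean : ∫ x, (x + b) ∂(gaussianReal 0 v) = b := by
    rw [integral_add (hid.integrable one_le_two) (integrable_const b), integral_id_gaussianReal]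
    simp
  have hvar := variance_eq_sub hshift
  rw [variance_add_const hid.aestronglyMeasurable, variance_fun_id_gaussianReal, hmean] at hvar
  rw [← ofReal_integral_eq_lintegral_ofReal hshift.integrable_sq (ae_of_all _ fun _ => sq_nonneg _)]
  simp only [Pi.pow_apply] at hvar
  rw [hvar, sub_add_cancel]

theorem hasLaw_gaussianReal_of_ae_tendsto {Ω : Type*} [MeasurableSpace Ω] {Q : Measure Ω}
    [IsProbabilityMeasure Q] {f : ℕ → Ω → ℝ} {Z : Ω → ℝ} {v : ℕ → NNReal} {w : NNReal}
    (hf : ∀ j, HasLaw (f j) (gaussianReal 0 (v j)) Q) (hv : Tendsto v atTop (𝓝 w))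
    (hZ : AEMeasurable Z Q) (hfZ : ∀ᵐ ω ∂Q, Tendsto (fun j => f j ω) atTop (𝓝 (Z ω))) :
    HasLaw Z (gaussianReal 0 w) Q := by
  have := Measure.isProbabilityMeasure_map hZ
  refine ⟨hZ, Measure.ext_of_charFun (funext fun t => ?_)⟩
  have hcharFun := ProbabilityMeasure.tendsto_iff_tendsto_charFun.1
    (tendstoInDistribution_of_ae_tendsto (fun j => (hf j).aemeasurable) hZ hfZ).tendsto t
  simp only [ProbabilityMeasure.coe_mk, (hf _).map_eq, charFun_gaussianReal] at hcharFun ⊢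
  have hcont : Continuous fun r : NNReal =>
      Complex.exp (t * (0 : ℝ) * Complex.I - (r : ℝ) * t ^ 2 / 2) := by fun_prop
  exact tendsto_nhds_unique hcharFun ((hcont.tendsto w).comp hv)

/-- The centered Gaussian family indexed by `E` and modelled on `T : E → H`: the random variables
`V g` have law `N(0, ‖T g‖²)`. Since `V` and `T` are linear, this determines their joint law. -/
def IsGaussianFamily {Ω E H : Type*} [MeasurableSpace Ω] [AddCommGroup E] [Module ℝ E]
    [NormedAddCommGroup H] [InnerProductSpace ℝ H] (V : E →ₗ[ℝ] (Ω → ℝ)) (T : E →ₗ[ℝ] H)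
    (Q : Measure Ω) : Prop :=
  ∀ g, HasLaw (V g) (gaussianReal 0 (‖T g‖₊ ^ 2)) Q

namespace IsGaussianFamily

variable {Ω E H : Type*} [MeasurableSpace Ω] [AddCommGroup E] [Module ℝ E]
    [NormedAddCommGroup H] [InnerProductSpace ℝ H] {V : E →ₗ[ℝ] (Ω → ℝ)} {T : E →ₗ[ℝ] H}
    {Q : Measure Ω}

theorem hasGaussianLaw (hV : IsGaussianFamily V T Q) (g : E) : HasGaussianLaw (V g) Q :=
  (hV g).hasGaussianLaw

theorem variance_eq (hV : IsGaussianFamily V T Q) (g : E) : Var[V g; Q] = ‖T g‖ ^ 2 := by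
  rw [(hV g).variance_eq, variance_id_gaussianReal]
  simp

theorem eLpNorm_two (hV : IsGaussianFamily V T Q) (g : E) :
    eLpNorm (V g) 2 Q = ENNReal.ofReal ‖T g‖ := by
  have hsq := lintegral_add_const_sq_gaussianReal (‖T g‖₊ ^ 2) 0
  rw [← (hV g).lintegral_comp (f := fun x => ENNReal.ofReal ((x + 0) ^ 2)) (by fun_prop)] at hsq
  rw [eLpNorm_eq_lintegral_rpow_enorm_toReal two_ne_zero (by simp)]
  simp only [add_zero, NNReal.coe_pow, coe_nnnorm, ne_eq, OfNat.ofNat_ne_zero, not_false_eq_true,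
    zero_pow] at hsq
  simp only [ENNReal.toReal_ofNat, ENNReal.rpow_ofNat, Real.enorm_eq_ofReal_abs,
    ← ENNReal.ofReal_pow (abs_nonneg _), sq_abs, hsq]
  rw [ENNReal.ofReal_rpow_of_nonneg (by positivity) (by positivity), ← Real.sqrt_eq_rpow,
    Real.sqrt_sq (norm_nonneg _)]

theorem isGaussianProcess (hV : IsGaussianFamily V T Q) {ι : Type*}
    (v : ι → E) : IsGaussianProcess (fun i => V (v i)) Q := by
  classical
  refine ⟨fun I => ⟨⟨fun L => ?_⟩⟩⟩
  have hmeas : AEMeasurable (fun ω => I.restrict fun i => V (v i) ω) Q :=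
    aemeasurable_pi_lambda _ fun i => (hV _).aemeasurable
  have hL : L ∘ (fun ω => I.restrict fun i => V (v i) ω) =
      V (∑ i : I, L (fun j => if i = j then 1 else 0) • v i) := by
    ext ω
    rw [Function.comp_apply, ← ContinuousLinearMap.coe_coe, LinearMap.pi_apply_eq_sum_univ]
    simp [mul_comm]
  have hgauss :=
    (hV.hasGaussianLaw (∑ i : I, L (fun j => if i = j then 1 else 0) • v i)).map_eq_gaussianReal
  rw [← hL, ← AEMeasurable.map_map_of_aemeasurable (by fun_prop) hmeas] at hgauss
  rw [hgauss, integral_map hmeas (by fun_prop), variance_map (by fun_prop) hmeas]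
  rfl

theorem covariance_eq (hV : IsGaussianFamily V T Q) (f g : E) :
    cov[V f, V g; Q] = ⟪T f, T g⟫ := by
  have := (hV 0).isProbabilityMeasure
  have hpolar := hV.variance_eq (f + g)
  rw [map_add, map_add,
    variance_add (hV.hasGaussianLaw f).memLp_two (hV.hasGaussianLaw g).memLp_two,
    hV.variance_eq, hV.variance_eq, norm_add_sq_real] at hpolar
  linarith

theorem indepFun_of_inner_eq_zero (hV : IsGaussianFamily V T Q) {ι : Type*} {g : E} {v : ι → E}
    (hgv : ∀ i, ⟪T g, T (v i)⟫ = 0) : IndepFun (V g) (fun ω i => V (v i) ω) Q := by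
  have := (hV 0).isProbabilityMeasure
  have hjoint : IsGaussianProcess (Sum.elim (fun _ : Unit => V g) fun i => V (v i)) Q := by
    have hcomp : V ∘ Sum.elim (fun _ : Unit => g) v = Sum.elim (fun _ => V g) fun i => V (v i) :=
      Sum.comp_elim ..
    exact hcomp ▸ hV.isGaussianProcess (Sum.elim (fun _ => g) v)
  exact (hjoint.indepFun_of_covariance_eq_zero (fun _ => (hV _).aemeasurable)
    (fun _ => (hV _).aemeasurable) fun _ i => (hV.covariance_eq g (v i)).trans (hgv i)).comp
      (measurable_pi_apply ()) measurable_id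

theorem hasLaw_of_tendsto (hV : IsGaussianFamily V T Q) {g : ℕ → E} {h : H} {Z : Ω → ℝ}
    (hZ : AEMeasurable Z Q) (hT : Tendsto (fun j => T (g j)) atTop (𝓝 h))
    (hgZ : ∀ᵐ ω ∂Q, Tendsto (fun j => V (g j) ω) atTop (𝓝 (Z ω))) :
    HasLaw Z (gaussianReal 0 (‖h‖₊ ^ 2)) Q :=
  have := (hV 0).isProbabilityMeasure
  hasLaw_gaussianReal_of_ae_tendsto (fun j => hV (g j)) (hT.nnnorm.pow 2) hZ hgZ

theorem coprod_of_tendsto (hV : IsGaussianFamily V T Q) {g : ℕ → E} {h : H} {Z : Ω → ℝ}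
    (hZ : AEMeasurable Z Q) (hT : Tendsto (fun j => T (g j)) atTop (𝓝 h))
    (hgZ : ∀ᵐ ω ∂Q, Tendsto (fun j => V (g j) ω) atTop (𝓝 (Z ω))) :
    IsGaussianFamily (V.coprod (LinearMap.toSpanSingleton ℝ _ Z))
      (T.coprod (LinearMap.toSpanSingleton ℝ H h)) Q := fun ⟨f, s⟩ => by
  refine hV.hasLaw_of_tendsto (g := fun j => f + s • g j) ?_ ?_ ?_
  · simpa using (hV f).aemeasurable.add (hZ.const_smul s)
  · simpa using (hT.const_smul s).const_add (T f)
  · filter_upwards [hgZ] with ω hω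
    simpa using (hω.const_mul s).const_add (V f ω)

theorem ae_exists_tendsto (hV : IsGaussianFamily V T Q) {g : ℕ → E} {h : H} {C : ℝ}
    (hg : ∀ j, ‖T (g j) - h‖ ≤ C * (1 / 2) ^ j) :
    ∀ᵐ ω ∂Q, ∃ z, Tendsto (fun j => V (g j) ω) atTop (𝓝 z) := by
  have hC : 0 ≤ C := by simpa using (norm_nonneg _).trans (hg 0)
  have hsum : Summable fun j : ℕ => (2 * C + 1) * (1 / 2 : ℝ) ^ j :=
    summable_geometric_two.mul_left _
  refine Lp.ae_tendsto_of_cauchy_eLpNorm (fun j => (hV (g j)).aemeasurable.aestronglyMeasurable)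
    one_le_two (B := fun N => ENNReal.ofReal ((2 * C + 1) * (1 / 2) ^ N)) hsum.tsum_ofReal_ne_top
    fun N n m hn hm => ?_
  have hN : (0 : ℝ) < (1 / 2) ^ N := by positivity
  have hclose : ∀ i, N ≤ i → ‖T (g i) - h‖ ≤ C * (1 / 2) ^ N := fun i hi => (hg i).trans <|
    mul_le_mul_of_nonneg_left (pow_le_pow_of_le_one (by norm_num) (by norm_num) hi) hC
  rw [← map_sub, hV.eLpNorm_two, map_sub, ← sub_sub_sub_cancel_right _ _ h]
  refine (ENNReal.ofReal_lt_ofReal_iff (by positivity)).2 ((norm_sub_le _ _).trans_lt ?_)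
  linarith [hclose n hn, hclose m hm]

end IsGaussianFamily

end GaussianFamily

/-! ### The noise as a Gaussian family -/

section Noise

variable {X : Type*} [NormedAddCommGroup X] [InnerProductSpace ℝ X]

/-- The functional `x ↦ ∑ₖ gₖ xₖ` on sequences, for finitely supported coefficients: the pairing of
a draw of the noise, given by its coordinates, with `finVec φ g`. -/
noncomputable def finEval : (ℕ →₀ ℝ) →ₗ[ℝ] ((ℕ → ℝ) → ℝ) :=
  Finsupp.linearCombination ℝ fun k x => x k

/-- The vector `∑ₖ gₖ φₖ`, for finitely supported coefficients. -/
noncomputable def finVec (φ : HilbertBasis ℕ ℝ X) : (ℕ →₀ ℝ) →ₗ[ℝ] X :=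
  Finsupp.linearCombination ℝ φ

theorem finEval_apply (g : ℕ →₀ ℝ) (x : ℕ → ℝ) :
    finEval g x = ∑ k ∈ g.support, g k * x k := by
  simp [finEval, Finsupp.linearCombination_apply, Finsupp.sum]

theorem finVec_apply (φ : HilbertBasis ℕ ℝ X) (g : ℕ →₀ ℝ) :
    finVec φ g = ∑ k ∈ g.support, g k • φ k := by
  simp [finVec, Finsupp.linearCombination_apply, Finsupp.sum]

theorem finEval_single (k : ℕ) (c : ℝ) (x : ℕ → ℝ) :
    finEval (Finsupp.single k c) x = c * x k := by
  simp [finEval]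

theorem finVec_single (φ : HilbertBasis ℕ ℝ X) (k : ℕ) (c : ℝ) :
    finVec φ (Finsupp.single k c) = c • φ k := by
  simp [finVec]

theorem finEval_inner (φ : HilbertBasis ℕ ℝ X) (g : ℕ →₀ ℝ) (v : X) :
    finEval g (fun k => ⟪φ k, v⟫) = ⟪finVec φ g, v⟫ := by
  simp [finEval_apply, finVec_apply, sum_inner, inner_smul_left]

theorem finEval_add_smul (g : ℕ →₀ ℝ) (c : ℝ) (x y : ℕ → ℝ) :
    finEval g (x + c • y) = finEval g x + c * finEval g y := by
  simp only [finEval_apply, Pi.add_apply, Pi.smul_apply, smul_eq_mul, mul_add,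
    Finset.sum_add_distrib, Finset.mul_sum]
  exact congrArg _ (Finset.sum_congr rfl fun k _ => mul_left_comm _ _ _)

theorem measurable_finEval (g : ℕ →₀ ℝ) : Measurable (finEval g) := by
  rw [show finEval g = fun x => ∑ k ∈ g.support, g k * x k from funext (finEval_apply g)]
  fun_prop

/-- The limit of the functionals `finEval (g j)`. It is defined as a `limsup` in order to be
measurable, and used only at points where the limit exists. -/
noncomputable def limEval (g : ℕ → ℕ →₀ ℝ) (x : ℕ → ℝ) : ℝ :=
  limsup (fun j => finEval (g j) x) atTop

theorem measurable_limEval (g : ℕ → ℕ →₀ ℝ) : Measurable (limEval g) :=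
  Measurable.limsup fun j => measurable_finEval (g j)

theorem limEval_eq {g : ℕ → ℕ →₀ ℝ} {x : ℕ → ℝ} {z : ℝ}
    (h : Tendsto (fun j => finEval (g j) x) atTop (𝓝 z)) : limEval g x = z :=
  h.limsup_eq

theorem tendsto_of_norm_sub_le_geometric {E : Type*} [NormedAddCommGroup E] {f : ℕ → E} {h : E}
    (hf : ∀ j, ‖f j - h‖ ≤ (1 / 2) ^ j) : Tendsto f atTop (𝓝 h) :=
  tendsto_iff_norm_sub_tendsto_zero.2 <| squeeze_zero (fun _ => norm_nonneg _) hf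
    (tendsto_pow_atTop_nhds_zero_of_lt_one (by norm_num) (by norm_num))

variable {H : Type*} [NormedAddCommGroup H] [InnerProductSpace ℝ H] [CompleteSpace H]
  [CompleteSpace X] {R : H →L[ℝ] X} {φ : HilbertBasis ℕ ℝ X}

theorem denseRange_adjoint_finVec (hR : Function.Injective R) :
    DenseRange fun g => R.adjoint (finVec φ g) := by
  have hbot : (LinearMap.range (R.adjoint.toLinearMap ∘ₗ finVec φ))ᗮ = ⊥ := by
    refine (Submodule.eq_bot_iff _).2 fun v hv => hR ?_
    have hcoord : ∀ k, ⟪φ k, R v⟫ = 0 := fun k => by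
      rw [← R.adjoint_inner_left]
      exact hv _ ⟨Finsupp.single k 1, by simp [finVec_single]⟩
    rw [map_zero, ← φ.repr.map_eq_zero_iff]
    ext k
    simpa [φ.repr_apply_apply] using hcoord k
  exact Submodule.dense_iff_topologicalClosure_eq_top.2
    (Submodule.topologicalClosure_eq_top_iff.2 hbot)

theorem exists_seq_adjoint_finVec (hR : Function.Injective R) (φ : HilbertBasis ℕ ℝ X) (h : H) :
    ∃ g : ℕ → ℕ →₀ ℝ, ∀ j, ‖R.adjoint (finVec φ (g j)) - h‖ ≤ (1 / 2) ^ j := by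
  choose g hg using fun j : ℕ =>
    (denseRange_adjoint_finVec (φ := φ) hR).exists_dist_lt h (show (0 : ℝ) < (1 / 2) ^ j by
      positivity)
  exact ⟨g, fun j => by simpa [dist_comm h, dist_eq_norm] using (hg j).le⟩

variable {P : Measure (ℕ → ℝ)}

theorem isGaussianFamily_finEval (hP : IsCenteredGaussianSeq P φ (R ∘L R.adjoint)) :
    IsGaussianFamily finEval (R.adjoint.toLinearMap ∘ₗ finVec φ) P := fun g => by
  have hfun : finEval g = fun x => ∑ k ∈ g.support, g k * x k := funext (finEval_apply g)
  have hgauss : HasGaussianLaw (finEval g) P := by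
    rw [hfun]
    simpa using (hP.isGaussian.smul g).hasGaussianLaw_fun_sum (I := g.support)
  have := hgauss.isProbabilityMeasure
  have hLp : ∀ k, MemLp (fun x : ℕ → ℝ => g k * x k) 2 P := fun k =>
    (hP.isGaussian.hasGaussianLaw_eval k).memLp_two.const_mul (g k)
  have hmean : ∫ x, finEval g x ∂P = 0 := by
    rw [hfun, integral_finsetSum _ fun k _ => (hLp k).integrable one_le_two]
    simp [integral_const_mul, hP.mean]
  have hvar : Var[finEval g; P] = ‖R.adjoint (finVec φ g)‖ ^ 2 := by
    rw [hfun, variance_fun_sum' fun k _ => hLp k, ← real_inner_self_eq_norm_sq, finVec_apply,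
      map_sum, sum_inner]
    simp_rw [inner_sum]
    refine Finset.sum_congr rfl fun i _ => Finset.sum_congr rfl fun j _ => ?_
    rw [covariance_const_mul_left, covariance_const_mul_right, hP.cov, map_smul, map_smul,
      real_inner_smul_left, real_inner_smul_right, ContinuousLinearMap.comp_apply,
      ← R.adjoint_inner_right]
  refine ⟨hgauss.aemeasurable, ?_⟩
  rw [hgauss.map_eq_gaussianReal, hmean, hvar]
  congr 1
  ext
  simp

theorem ae_tendsto_limEval (hP : IsCenteredGaussianSeq P φ (R ∘L R.adjoint)) {g : ℕ → ℕ →₀ ℝ}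
    {h : H} (hg : ∀ j, ‖R.adjoint (finVec φ (g j)) - h‖ ≤ (1 / 2) ^ j) :
    ∀ᵐ x ∂P, Tendsto (fun j => finEval (g j) x) atTop (𝓝 (limEval g x)) := by
  filter_upwards [(isGaussianFamily_finEval hP).ae_exists_tendsto (g := g) (C := 1)
    (by simpa using hg)] with x ⟨z, hz⟩
  rwa [limEval_eq hz]

theorem isGaussianFamily_coprod_limEval (hP : IsCenteredGaussianSeq P φ (R ∘L R.adjoint))
    {g : ℕ → ℕ →₀ ℝ} {h : H} (hg : ∀ j, ‖R.adjoint (finVec φ (g j)) - h‖ ≤ (1 / 2) ^ j) :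
    IsGaussianFamily (finEval.coprod (LinearMap.toSpanSingleton ℝ _ (limEval g)))
      ((R.adjoint.toLinearMap ∘ₗ finVec φ).coprod (LinearMap.toSpanSingleton ℝ H h)) P :=
  (isGaussianFamily_finEval hP).coprod_of_tendsto (measurable_limEval g).aemeasurable
    (tendsto_of_norm_sub_le_geometric hg) (ae_tendsto_limEval hP hg)

theorem hasLaw_limEval (hP : IsCenteredGaussianSeq P φ (R ∘L R.adjoint))
    {g : ℕ → ℕ →₀ ℝ} {h : H} (hg : ∀ j, ‖R.adjoint (finVec φ (g j)) - h‖ ≤ (1 / 2) ^ j) :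
    HasLaw (limEval g) (gaussianReal 0 (‖h‖₊ ^ 2)) P := by
  simpa using isGaussianFamily_coprod_limEval hP hg (0, 1)

theorem indepFun_limEval_sub (hP : IsCenteredGaussianSeq P φ (R ∘L R.adjoint))
    {g : ℕ → ℕ →₀ ℝ} {h : H} (hg : ∀ j, ‖R.adjoint (finVec φ (g j)) - h‖ ≤ (1 / 2) ^ j)
    {a : ℕ → ℝ} (ha : ∀ k, a k * ‖h‖ ^ 2 = ⟪φ k, R h⟫) :
    IndepFun (limEval g) (fun x k => x k - a k * limEval g x) P := by
  have hind := (isGaussianFamily_coprod_limEval hP hg).indepFun_of_inner_eq_zero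
    (g := (0, 1)) (v := fun k => (Finsupp.single k 1, -a k)) fun k => by
      simp [finVec_single, inner_add_right, inner_smul_right, R.adjoint_inner_right, ha,
        real_inner_comm]
  simpa [finEval_single, sub_eq_add_neg] using hind

theorem map_add_prodMk_absolutelyContinuous {Ω S : Type*} [MeasurableSpace Ω] [MeasurableSpace S]
    {Q : Measure Ω} [IsFiniteMeasure Q] {W : Ω → ℝ} {Y : Ω → S} {v : NNReal} (hv : v ≠ 0)
    (hW : HasLaw W (gaussianReal 0 v) Q) (hY : AEMeasurable Y Q) (hWY : IndepFun W Y Q) (b : ℝ) :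
    Q.map (fun ω => (W ω + b, Y ω)) ≪ Q.map (fun ω => (W ω, Y ω)) := by
  have hshift : IndepFun (fun ω => W ω + b) Y Q :=
    hWY.comp (measurable_id.add_const b) measurable_id
  have hWb := gaussianReal_add_const hW b
  rw [hshift.map_prod_eq_prod_map_map hWb.aemeasurable hY,
    hWY.map_prod_eq_prod_map_map hW.aemeasurable hY, hWb.map_eq, hW.map_eq]
  exact ((gaussianReal_absolutelyContinuous _ hv).trans
    (gaussianReal_absolutelyContinuous' _ hv)).prod .rfl

theorem map_add_inner_absolutelyContinuous (hR : Function.Injective R)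
    (hP : IsCenteredGaussianSeq P φ (R ∘L R.adjoint)) (h : H) :
    P.map (fun x k => x k + ⟪φ k, R h⟫) ≪ P := by
  rcases eq_or_ne h 0 with rfl | hne
  · simpa using (Measure.map_id (μ := P)).absolutelyContinuous
  obtain ⟨g, hg⟩ := exists_seq_adjoint_finVec hR φ h
  have hn : ‖h‖ ^ 2 ≠ 0 := pow_ne_zero 2 (norm_ne_zero_iff.2 hne)
  set a : ℕ → ℝ := fun k => ⟪φ k, R h⟫ / ‖h‖ ^ 2
  have hW := hasLaw_limEval hP hg
  have hWm := measurable_limEval g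
  have hYm : Measurable fun (x : ℕ → ℝ) k => x k - a k * limEval g x := by fun_prop
  have := hW.isProbabilityMeasure
  have hac := map_add_prodMk_absolutelyContinuous (pow_ne_zero 2 (nnnorm_ne_zero_iff.2 hne)) hW
    hYm.aemeasurable (indepFun_limEval_sub hP hg fun k => div_mul_cancel₀ _ hn) (‖h‖ ^ 2)
  have hΦ : Measurable fun (p : ℝ × (ℕ → ℝ)) k => p.2 k + a k * p.1 := by fun_prop
  have hmap := hac.map hΦ
  rw [Measure.map_map hΦ (by fun_prop), Measure.map_map hΦ (by fun_prop)] at hmap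
  convert hmap using 1
  · congr 1
    ext x k
    simp only [Function.comp_apply, a, mul_add, div_mul_cancel₀ _ hn]
    ring
  · simp [Function.comp_def]

end Noise

/-! ### Conditional laws in a location model -/

section Posterior

theorem compProd_map_prod_const {α β γ : Type*} [MeasurableSpace α] [MeasurableSpace β]
    [MeasurableSpace γ] (ν : Measure α) [SFinite ν] (ζ : Measure β) [IsProbabilityMeasure ζ]
    {Ψ : α × β → γ} (hΨ : Measurable Ψ) :
    ν ⊗ₘ ((Kernel.id ×ₖ Kernel.const α ζ).map Ψ) = (ν.prod ζ).map fun p => (p.1, Ψ p) := by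
  have := Kernel.IsMarkovKernel.map (Kernel.id ×ₖ Kernel.const α ζ) hΨ
  ext s hs
  have hm : Measurable fun p : α × β => (p.1, Ψ p) := by fun_prop
  rw [Measure.compProd_apply hs, Measure.map_apply hm hs, Measure.prod_apply (hm hs)]
  refine lintegral_congr fun a => ?_
  rw [Kernel.map_apply' _ hΨ _ (measurable_prodMk_left hs), Kernel.prod_apply, Kernel.id_apply,
    Kernel.const_apply, Measure.dirac_prod, Measure.map_apply (by fun_prop)
      (hΨ (measurable_prodMk_left hs))]
  rfl

variable {α γ : Type*} [MeasurableSpace α] [StandardBorelSpace α] [Nonempty α]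
  [MeasurableSpace γ] {κ : Kernel α γ} [IsMarkovKernel κ] {ν : Measure α}
  [IsProbabilityMeasure ν] {f : α → ℝ} {F : γ → ℝ} {Ω : Type*} [MeasurableSpace Ω] {Q : Measure Ω}
  {U : Ω → α} {Y : Ω → γ}

theorem posterior_map_ae_eq_of_indepFun (hf : Measurable f) (hF : Measurable F)
    (hUY : HasLaw (fun ω => (U ω, Y ω)) (ν ⊗ₘ κ) Q) {ζ : Measure ℝ} [IsProbabilityMeasure ζ]
    (hlaw : HasLaw (fun ω => f (U ω) - F (Y ω)) ζ Q)
    (hind : IndepFun (fun ω => f (U ω) - F (Y ω)) Y Q) :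
    ∀ᵐ y ∂(κ ∘ₘ ν), ((posterior κ ν) y).map f = ζ.map fun z => F y + z := by
  have := hlaw.isProbabilityMeasure
  have hY : HasLaw Y (κ ∘ₘ ν) Q :=
    HasLaw.fun_comp (X := fun ω => (U ω, Y ω))
      ⟨measurable_snd.aemeasurable, Measure.snd_compProd ..⟩ hUY
  have hΨ : Measurable fun p : γ × ℝ => F p.1 + p.2 := by fun_prop
  have := Kernel.IsMarkovKernel.map (Kernel.id ×ₖ Kernel.const γ ζ) hΨ
  have := Kernel.IsMarkovKernel.map (posterior κ ν) hf
  have hjoint : (ν ⊗ₘ κ).map (fun p => (p.2, f p.1 - F p.2)) = (κ ∘ₘ ν).prod ζ := by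
    have hprod := hind.symm.map_prod_eq_prod_map_map hY.aemeasurable hlaw.aemeasurable
    rw [hY.map_eq, hlaw.map_eq] at hprod
    rw [← hprod, ← hUY.map_eq, AEMeasurable.map_map_of_aemeasurable (by fun_prop) hUY.aemeasurable]
    rfl
  have hcompProd : (κ ∘ₘ ν) ⊗ₘ ((posterior κ ν).map f) =
      (κ ∘ₘ ν) ⊗ₘ ((Kernel.id ×ₖ Kernel.const γ ζ).map fun p => F p.1 + p.2) := by
    rw [compProd_map_prod_const _ _ hΨ, ← hjoint, Measure.map_map (by fun_prop) (by fun_prop),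
      Measure.compProd_map hf, compProd_posterior_eq_map_swap,
      Measure.map_map (by fun_prop) measurable_swap]
    congr 1
    ext p <;> simp
  filter_upwards [Kernel.ae_eq_of_compProd_eq hcompProd] with y hy
  rw [← Kernel.map_apply _ hf, hy, Kernel.map_apply _ hΨ, Kernel.prod_apply, Kernel.id_apply,
    Kernel.const_apply, Measure.dirac_prod, Measure.map_map hΨ (by fun_prop)]
  rfl

theorem lintegral_posterior_sub_sq (hf : Measurable f) (hF : Measurable F)
    (hUY : HasLaw (fun ω => (U ω, Y ω)) (ν ⊗ₘ κ) Q) {v : NNReal}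
    (hlaw : HasLaw (fun ω => f (U ω) - F (Y ω)) (gaussianReal 0 v) Q)
    (hind : IndepFun (fun ω => f (U ω) - F (Y ω)) Y Q)
    {ρ : Measure γ} [IsProbabilityMeasure ρ] (hρ : ρ ≪ κ ∘ₘ ν) (c : ℝ) :
    ∫⁻ y, ∫⁻ u, ENNReal.ofReal ((f u - c) ^ 2) ∂(posterior κ ν y) ∂ρ =
      v + ∫⁻ y, ENNReal.ofReal ((F y - c) ^ 2) ∂ρ := by
  rw [← mul_one (v : ENNReal), ← measure_univ (μ := ρ), ← lintegral_const,
    ← lintegral_add_left measurable_const]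
  refine lintegral_congr_ae ?_
  filter_upwards [hρ.ae_le (posterior_map_ae_eq_of_indepFun hf hF hUY hlaw hind)] with y hy
  rw [← lintegral_map (f := fun r : ℝ => ENNReal.ofReal ((r - c) ^ 2)) (by fun_prop) hf, hy,
    lintegral_map (by fun_prop) (by fun_prop), ← ENNReal.ofReal_coe_nnreal,
    ← ENNReal.ofReal_add v.coe_nonneg (sq_nonneg _)]
  refine (lintegral_congr fun z => ?_).trans (lintegral_add_const_sq_gaussianReal v (F y - c))
  ring_nf

end Posterior

/-! ### The posterior law of a linear functional -/

section Model

variable {X : Type*} [NormedAddCommGroup X] [InnerProductSpace ℝ X]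

/-- The functionals `(u, x) ↦ ⟨a, u⟩ + ∑ₖ gₖ xₖ` of the parameter and the noise. -/
noncomputable def pairEval : (X × (ℕ →₀ ℝ)) →ₗ[ℝ] (X × (ℕ → ℝ) → ℝ) :=
  (LinearMap.pi fun p => (innerₗ X).flip p.1).coprod
    (LinearMap.funLeft ℝ ℝ Prod.snd ∘ₗ finEval)

theorem pairEval_apply (a : X) (g : ℕ →₀ ℝ) (u : X) (x : ℕ → ℝ) :
    pairEval (a, g) (u, x) = ⟪a, u⟫ + finEval g x := by
  simp [pairEval, LinearMap.funLeft_apply, real_inner_comm]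

theorem finEval_sqrt_smul_dataOf {n : ℕ} (hn : n ≠ 0) (φ : HilbertBasis ℕ ℝ X) (K : X →L[ℝ] X)
    (g : ℕ →₀ ℝ) (u : X) (x : ℕ → ℝ) :
    finEval g (√(n : ℝ) • dataOf φ K n (u, x)) = finEval g x + √(n : ℝ) * ⟪finVec φ g, K u⟫ := by
  have hsn : √(n : ℝ) ≠ 0 := by positivity
  rw [← finEval_inner, ← finEval_add_smul]
  refine congrArg (finEval g) (funext fun k => ?_)
  simp only [dataOf, Pi.smul_apply, Pi.add_apply, smul_eq_mul]
  field_simp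
  ring

theorem compProd_likelihood [MeasurableSpace X] [BorelSpace X] (φ : HilbertBasis ℕ ℝ X)
    (K : X →L[ℝ] X) (n : ℕ) (ν : Measure X) [SFinite ν] (P : Measure (ℕ → ℝ))
    [IsProbabilityMeasure P] :
    ν ⊗ₘ likelihood φ K P n = (ν.prod P).map fun p => (p.1, dataOf φ K n p) :=
  compProd_map_prod_const ν P (measurable_dataOf φ K n)

variable [CompleteSpace X]
  {H H' : Type*} [NormedAddCommGroup H] [InnerProductSpace ℝ H] [CompleteSpace H]
  [NormedAddCommGroup H'] [InnerProductSpace ℝ H'] [CompleteSpace H']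
  {φ : HilbertBasis ℕ ℝ X} {K : X →L[ℝ] X} {D : H' →L[ℝ] X} {R : H →L[ℝ] X} {M : H' →L[ℝ] H}
  {n : ℕ} {τ : ℝ}

/-- The vector in the product of the Cameron-Martin spaces on which `pairEval` is modelled, for a
prior with covariance `τ² D D*` and a noise with covariance `R R*`. -/
noncomputable def pairVec (φ : HilbertBasis ℕ ℝ X) (D : H' →L[ℝ] X) (R : H →L[ℝ] X) (τ : ℝ) :
    (X × (ℕ →₀ ℝ)) →ₗ[ℝ] WithLp 2 (H' × H) :=
  (WithLp.linearEquiv 2 ℝ (H' × H)).symm.toLinearMap ∘ₗ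
    ((τ • D.adjoint.toLinearMap).prodMap (R.adjoint.toLinearMap ∘ₗ finVec φ))

theorem pairVec_apply (a : X) (g : ℕ →₀ ℝ) : pairVec φ D R τ (a, g) =
    WithLp.toLp 2 (τ • D.adjoint a, R.adjoint (finVec φ g)) := rfl

theorem pairEval_residual (hn : n ≠ 0) (e : X) (g : ℕ →₀ ℝ) (p : X × (ℕ → ℝ)) :
    pairEval (e - √(n : ℝ) • K.adjoint (finVec φ g), -g) p =
      ⟪e, p.1⟫ - finEval g (√(n : ℝ) • dataOf φ K n p) := by
  obtain ⟨u, x⟩ := p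
  rw [pairEval_apply, finEval_sqrt_smul_dataOf hn, inner_sub_left, real_inner_smul_left,
    K.adjoint_inner_left, map_neg, Pi.neg_apply]
  ring

theorem pairEval_dataOf (k : ℕ) (p : X × (ℕ → ℝ)) :
    pairEval (K.adjoint (φ k), Finsupp.single k (√(n : ℝ))⁻¹) p = dataOf φ K n p k := by
  obtain ⟨u, x⟩ := p
  rw [pairEval_apply, finEval_single, K.adjoint_inner_left, dataOf]

theorem adjoint_adjoint_apply_of_comp_eq (hM : R ∘L M = K ∘L D) (x : X) :
    D.adjoint (K.adjoint x) = M.adjoint (R.adjoint x) := by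
  simpa only [ContinuousLinearMap.adjoint_comp, ContinuousLinearMap.comp_apply] using
    (congrArg (fun L => L.adjoint x) hM).symm

theorem inner_residual_dataOf (hn : n ≠ 0) (hM : R ∘L M = K ∘L D) {h : H} {p : H'}
    (hh : h = (√(n : ℝ) * τ ^ 2) • M p) (k : ℕ) :
    ⟪WithLp.toLp 2 (τ • p, -h), pairVec φ D R τ
      (K.adjoint (φ k), Finsupp.single k (√(n : ℝ))⁻¹)⟫ = 0 := by
  have hsn : √(n : ℝ) ≠ 0 := by positivity
  rw [pairVec_apply, adjoint_adjoint_apply_of_comp_eq hM, WithLp.prod_inner_apply, finVec_single]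
  simp only [map_smul, real_inner_smul_left, real_inner_smul_right, inner_neg_left,
    M.adjoint_inner_right, hh]
  field_simp
  ring

theorem norm_residual_le (hM : R ∘L M = K ∘L D) {e : X} {h : H} {p : H'}
    (hp : p + √(n : ℝ) • M.adjoint h = D.adjoint e) (g : ℕ →₀ ℝ) :
    ‖pairVec φ D R τ (e - √(n : ℝ) • K.adjoint (finVec φ g), -g) - WithLp.toLp 2 (τ • p, -h)‖ ≤
      (|τ| * √(n : ℝ) * ‖M.adjoint‖ + 1) * ‖R.adjoint (finVec φ g) - h‖ := by
  set δ := R.adjoint (finVec φ g) - h with hδ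
  have hfst : τ • D.adjoint (e - √(n : ℝ) • K.adjoint (finVec φ g)) - τ • p =
      -(τ * √(n : ℝ)) • M.adjoint δ := by
    rw [map_sub, map_smul, adjoint_adjoint_apply_of_comp_eq hM, ← hp, hδ, map_sub]
    module
  have hsnd : R.adjoint (finVec φ (-g)) - -h = -δ := by
    rw [map_neg, map_neg, hδ]
    abel
  have hsum : ∀ a : H', ∀ b : H, ‖WithLp.toLp 2 (a, b)‖ ≤ ‖a‖ + ‖b‖ := fun a b => by
    rw [WithLp.prod_norm_eq_of_L2]
    refine Real.sqrt_le_iff.2 ⟨by positivity, ?_⟩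
    change ‖a‖ ^ 2 + ‖b‖ ^ 2 ≤ (‖a‖ + ‖b‖) ^ 2
    nlinarith [mul_nonneg (norm_nonneg a) (norm_nonneg b)]
  rw [pairVec_apply, ← WithLp.toLp_sub, Prod.mk_sub_mk, hfst, hsnd]
  refine (hsum _ _).trans ?_
  rw [norm_smul, norm_neg, norm_neg, Real.norm_eq_abs, abs_mul, abs_of_nonneg (Real.sqrt_nonneg _),
    add_mul, one_mul, mul_assoc _ ‖_‖]
  gcongr
  exact M.adjoint.le_opNorm δ

theorem norm_residual_sq {e : X} {h : H} {p : H'} (hh : h = (√(n : ℝ) * τ ^ 2) • M p)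
    (hp : p + √(n : ℝ) • M.adjoint h = D.adjoint e) :
    ‖WithLp.toLp 2 (τ • p, -h)‖ ^ 2 = τ ^ 2 * ⟪D.adjoint e, p⟫ := by
  have hinner : ⟪D.adjoint e, p⟫ = ‖p‖ ^ 2 + n * τ ^ 2 * ‖M p‖ ^ 2 := by
    rw [← hp, inner_add_left, real_inner_smul_left, M.adjoint_inner_left, hh, real_inner_smul_left,
      real_inner_self_eq_norm_sq, real_inner_self_eq_norm_sq]
    linear_combination τ ^ 2 * ‖M p‖ ^ 2 * Real.mul_self_sqrt n.cast_nonneg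
  rw [WithLp.prod_norm_sq_eq_of_L2, hinner]
  change ‖τ • p‖ ^ 2 + ‖-h‖ ^ 2 = _
  rw [norm_neg, hh, norm_smul, norm_smul, mul_pow, mul_pow, Real.norm_eq_abs, Real.norm_eq_abs,
    sq_abs, sq_abs, mul_pow, Real.sq_sqrt n.cast_nonneg]
  ring

theorem norm_sq_le_of_residual {e : X} {h : H} {p : H'} (hh : h = (√(n : ℝ) * τ ^ 2) • M p)
    (hp : p + √(n : ℝ) • M.adjoint h = D.adjoint e) :
    ‖h‖ ^ 2 ≤ τ ^ 2 * ⟪D.adjoint e, p⟫ := by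
  rw [← norm_residual_sq hh hp, WithLp.prod_norm_sq_eq_of_L2]
  change _ ≤ ‖τ • p‖ ^ 2 + ‖-h‖ ^ 2
  rw [norm_neg]
  linarith [sq_nonneg ‖τ • p‖]

theorem ae_limEval_sqrt_smul_dataOf {P : Measure (ℕ → ℝ)}
    (hP : IsCenteredGaussianSeq P φ (R ∘L R.adjoint))
    (hM : R ∘L M = K ∘L D) (hn : n ≠ 0) {e : X} {h : H} {p : H'}
    (hp : p + √(n : ℝ) • M.adjoint h = D.adjoint e) {g : ℕ → ℕ →₀ ℝ}
    (hg : ∀ j, ‖R.adjoint (finVec φ (g j)) - h‖ ≤ (1 / 2) ^ j) (z : H') : ∀ᵐ x ∂P,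
    limEval g (√(n : ℝ) • dataOf φ K n (D z, x)) - ⟪e, D z⟫ = limEval g x + -⟪p, z⟫ := by
  have hbias : √(n : ℝ) * ⟪h, M z⟫ - ⟪e, D z⟫ = -⟪p, z⟫ := by
    rw [← D.adjoint_inner_left, ← hp, inner_add_left, real_inner_smul_left, M.adjoint_inner_left]
    ring
  filter_upwards [ae_tendsto_limEval hP hg] with x hx
  have hlim : Tendsto (fun j => finEval (g j) (√(n : ℝ) • dataOf φ K n (D z, x))) atTop
      (𝓝 (limEval g x + √(n : ℝ) * ⟪h, M z⟫)) := by
    simp_rw [finEval_sqrt_smul_dataOf hn, ← ContinuousLinearMap.comp_apply K D, ← hM,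
      ContinuousLinearMap.comp_apply, ← R.adjoint_inner_left]
    exact hx.add (((tendsto_of_norm_sub_le_geometric hg).inner tendsto_const_nhds).const_mul _)
  rw [limEval_eq hlim, ← hbias]
  ring

variable [MeasurableSpace X] [BorelSpace X] {μ : Measure X}
  {P : Measure (ℕ → ℝ)} [IsProbabilityMeasure P]

/-- The laws of the data at any two parameters in the domain of `C₁^{-1/2} K` are mutually
absolutely continuous by the Cameron-Martin theorem, so it is enough that the prior charges that
domain. -/
theorem likelihood_absolutelyContinuous {ν : Measure X} [NeZero ν] [SFinite ν]
    (hR : Function.Injective R)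
    (hP : IsCenteredGaussianSeq P φ (R ∘L R.adjoint)) (hn : n ≠ 0)
    (hrange : ∀ᵐ u ∂ν, ∃ w, R w = K u) {u' : X} (hu' : ∃ w, R w = K u') :
    likelihood φ K P n u' ≪ likelihood φ K P n ∘ₘ ν := by
  refine Measure.AbsolutelyContinuous.mk fun s hs hnull => ?_
  rw [Measure.bind_apply hs (Kernel.aemeasurable _),
    lintegral_eq_zero_iff (Kernel.measurable_coe _ hs)] at hnull
  obtain ⟨w', hw'⟩ := hu'
  obtain ⟨u, hu, w, hw⟩ := (hnull.and hrange).exists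
  have hmeas : ∀ v : X, Measurable fun x => dataOf φ K n (v, x) := fun v =>
    (measurable_dataOf φ K n).comp measurable_prodMk_left
  have hsn : √(n : ℝ) ≠ 0 := by positivity
  have hshift : ∀ x, dataOf φ K n (u', x) =
      dataOf φ K n (u, fun k => x k + ⟪φ k, R (√(n : ℝ) • (w' - w))⟫) := fun x => by
    ext k
    simp only [dataOf, map_smul, map_sub, hw', hw, inner_smul_right, inner_sub_right]
    field_simp
    ring
  simp only [Pi.zero_apply, likelihood_apply] at hu
  rw [Measure.map_apply (hmeas u) hs] at hu
  rw [likelihood_apply, Measure.map_apply (hmeas u') hs]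
  have hac := map_add_inner_absolutelyContinuous hR hP (√(n : ℝ) • (w' - w)) hu
  rw [Measure.map_apply (by fun_prop) (hmeas u hs)] at hac
  simpa only [Set.preimage, Set.mem_ofPred_eq, hshift] using hac

instance isProbabilityMeasure_prior (μ : Measure X) [IsProbabilityMeasure μ] (τ : ℝ) :
    IsProbabilityMeasure (prior μ τ) :=
  Measure.isProbabilityMeasure_map (by fun_prop)

theorem lintegral_posteriorMean_sub_sq (hP : IsCenteredGaussianSeq P φ (R ∘L R.adjoint))
    (hM : R ∘L M = K ∘L D) (hn : n ≠ 0) {e : X} {h : H} {p : H'}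
    (hp : p + √(n : ℝ) • M.adjoint h = D.adjoint e) {g : ℕ → ℕ →₀ ℝ}
    (hg : ∀ j, ‖R.adjoint (finVec φ (g j)) - h‖ ≤ (1 / 2) ^ j) (z : H') :
    ∫⁻ y, ENNReal.ofReal ((limEval g (√(n : ℝ) • y) - ⟪e, D z⟫) ^ 2) ∂(likelihood φ K P n (D z)) =
      ENNReal.ofReal (‖h‖ ^ 2 + ⟪p, z⟫ ^ 2) := by
  have hmeas : Measurable (limEval g) := measurable_limEval g
  have hdata : Measurable fun x => dataOf φ K n (D z, x) :=
    (measurable_dataOf φ K n).comp measurable_prodMk_left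
  have hgauss := lintegral_add_const_sq_gaussianReal (‖h‖₊ ^ 2) (-⟪p, z⟫)
  rw [← (hasLaw_limEval hP hg).lintegral_comp (by fun_prop), neg_sq] at hgauss
  rw [likelihood_apply, lintegral_map (by fun_prop) hdata, ← coe_nnnorm, ← NNReal.coe_pow, ← hgauss]
  refine lintegral_congr_ae ?_
  filter_upwards [ae_limEval_sqrt_smul_dataOf hP hM hn hp hg z] with x hx
  rw [hx]

variable [SecondCountableTopology X]

theorem hasLaw_inner_prior (hμ : IsCenteredGaussian μ (D ∘L D.adjoint)) (τ : ℝ) (a : X) :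
    HasLaw (fun u => ⟪a, u⟫) (gaussianReal 0 (‖τ • D.adjoint a‖₊ ^ 2)) (prior μ τ) := by
  have := hμ.isGaussian
  have hm : Measurable fun u : X => ⟪a, u⟫ := by fun_prop
  have hfun : (fun u : X => ⟪a, u⟫) ∘ (τ • ·) = ⇑(τ • innerSL ℝ a) := by
    ext u
    simp [inner_smul_right]
  have hgauss : HasGaussianLaw (⇑(τ • innerSL ℝ a)) μ :=
    (IsGaussian.hasGaussianLaw_id (μ := μ)).map_fun (τ • innerSL ℝ a)
  have hmean : ∫ u, (τ • innerSL ℝ a) u ∂μ = 0 := by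
    rw [ContinuousLinearMap.integral_comp_comm (τ • innerSL ℝ a) (φ := fun u => u)
      IsGaussian.integrable_id, hμ.mean, map_zero]
  have hvar : Var[⇑(τ • innerSL ℝ a); μ] = ‖τ • D.adjoint a‖ ^ 2 := by
    have hcov := hμ.cov a a
    rw [covarianceBilin_apply_eq_cov IsGaussian.memLp_two_id, covariance_self (by fun_prop),
      ContinuousLinearMap.comp_apply, ← D.adjoint_inner_right, real_inner_self_eq_norm_sq] at hcov
    change Var[fun u => τ * ⟪a, u⟫; μ] = _
    rw [variance_const_mul, hcov, norm_smul, mul_pow, Real.norm_eq_abs, sq_abs]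
  refine ⟨hm.aemeasurable, ?_⟩
  rw [prior, Measure.map_map hm (by fun_prop), hfun, hgauss.map_eq_gaussianReal, hmean, hvar]
  congr 1
  ext
  simp

theorem isGaussianFamily_pairEval (hμ : IsCenteredGaussian μ (D ∘L D.adjoint))
    (hP : IsCenteredGaussianSeq P φ (R ∘L R.adjoint)) (τ : ℝ) :
    IsGaussianFamily pairEval (pairVec φ D R τ) ((prior μ τ).prod P) := fun ⟨a, g⟩ => by
  have := hμ.isGaussian
  have hinner := (hasLaw_inner_prior hμ τ a).fun_comp
    (MeasurePreserving.hasLaw (measurePreserving_fst (μ := prior μ τ) (ν := P)))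
  have heval := (isGaussianFamily_finEval hP g).fun_comp
    (MeasurePreserving.hasLaw (measurePreserving_snd (μ := prior μ τ) (ν := P)))
  have hind : IndepFun (fun p : X × (ℕ → ℝ) => ⟪a, p.1⟫) (fun p => finEval g p.2)
      ((prior μ τ).prod P) := indepFun_prod (by fun_prop) (measurable_finEval g)
  have hadd := gaussianReal_add_gaussianReal_of_indepFun hind hinner.map_eq heval.map_eq
  have hnorm : ‖pairVec φ D R τ (a, g)‖₊ ^ 2 =
      ‖τ • D.adjoint a‖₊ ^ 2 + ‖R.adjoint (finVec φ g)‖₊ ^ 2 := by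
    ext
    push_cast
    exact WithLp.prod_norm_sq_eq_of_L2 _
  have hfun : pairEval (a, g) = fun p : X × (ℕ → ℝ) => ⟪a, p.1⟫ + finEval g p.2 :=
    funext fun p => pairEval_apply a g p.1 p.2
  rw [hfun, hnorm]
  refine ⟨hinner.aemeasurable.add heval.aemeasurable, ?_⟩
  rw [add_zero] at hadd
  exact hadd

theorem isGaussianFamily_residual (hμ : IsCenteredGaussian μ (D ∘L D.adjoint))
    (hP : IsCenteredGaussianSeq P φ (R ∘L R.adjoint)) (hM : R ∘L M = K ∘L D) (hn : n ≠ 0)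
    {e : X} {h : H} {p : H'} (hp : p + √(n : ℝ) • M.adjoint h = D.adjoint e) {g : ℕ → ℕ →₀ ℝ}
    (hg : ∀ j, ‖R.adjoint (finVec φ (g j)) - h‖ ≤ (1 / 2) ^ j) :
    IsGaussianFamily
      (pairEval.coprod (LinearMap.toSpanSingleton ℝ _ fun s =>
        ⟪e, s.1⟫ - limEval g (√(n : ℝ) • dataOf φ K n s)))
      ((pairVec φ D R τ).coprod (LinearMap.toSpanSingleton ℝ _ (WithLp.toLp 2 (τ • p, -h))))
      ((prior μ τ).prod P) := by
  set q : ℕ → X × (ℕ →₀ ℝ) := fun j => (e - √(n : ℝ) • K.adjoint (finVec φ (g j)), -g j)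
  have hV := isGaussianFamily_pairEval hμ hP τ
  have hq : ∀ j, ‖pairVec φ D R τ (q j) - WithLp.toLp 2 (τ • p, -h)‖ ≤
      (|τ| * √(n : ℝ) * ‖M.adjoint‖ + 1) * (1 / 2) ^ j := fun j =>
    (norm_residual_le hM hp (g j)).trans (by gcongr; exact hg j)
  have hmeas := (measurable_limEval g).comp ((measurable_dataOf φ K n).const_smul √(n : ℝ))
  have hgeom : Tendsto (fun j : ℕ => (|τ| * √(n : ℝ) * ‖M.adjoint‖ + 1) * (1 / 2 : ℝ) ^ j) atTop
      (𝓝 0) := by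
    simpa using (tendsto_pow_atTop_nhds_zero_of_lt_one (r := (1 / 2 : ℝ)) (by norm_num)
      (by norm_num)).const_mul (|τ| * √(n : ℝ) * ‖M.adjoint‖ + 1)
  refine hV.coprod_of_tendsto (g := q) (Measurable.aemeasurable (by fun_prop))
    (tendsto_iff_norm_sub_tendsto_zero.2 (squeeze_zero (fun _ => norm_nonneg _) hq hgeom)) ?_
  filter_upwards [hV.ae_exists_tendsto hq] with s ⟨z, hz⟩
  have hlim : Tendsto (fun j => finEval (g j) (√(n : ℝ) • dataOf φ K n s)) atTop
      (𝓝 (⟪e, s.1⟫ - z)) := by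
    refine (hz.const_sub ⟪e, s.1⟫).congr fun j => ?_
    rw [pairEval_residual hn, sub_sub_cancel]
  rwa [limEval_eq hlim, sub_sub_cancel]

variable [IsProbabilityMeasure μ]

/-- The posterior mean square error of the functional `⟪e, u⟫`, where
`p = (1 + n τ² M* M)⁻¹ D* e` and the true parameter is `D z`. -/
theorem lintegral_posterior_inner_sub_sq_le (hμ : IsCenteredGaussian μ (D ∘L D.adjoint))
    (hP : IsCenteredGaussianSeq P φ (R ∘L R.adjoint)) (hM : R ∘L M = K ∘L D) (hn : n ≠ 0)
    (hR : Function.Injective R) (hrange : ∀ᵐ u ∂(prior μ τ), ∃ w, R w = K u) {e : X} {p : H'}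
    (hp : p + (n * τ ^ 2 : ℝ) • M.adjoint (M p) = D.adjoint e) (z : H') :
    ∫⁻ y, ∫⁻ u, ENNReal.ofReal ((⟪e, u⟫ - ⟪e, D z⟫) ^ 2) ∂(posteriorLaw φ K μ P n τ y)
        ∂(likelihood φ K P n (D z)) ≤
      ENNReal.ofReal (2 * (τ ^ 2 * ⟪D.adjoint e, p⟫) + ⟪p, z⟫ ^ 2) := by
  obtain ⟨h, hh⟩ : ∃ h, h = (√(n : ℝ) * τ ^ 2) • M p := ⟨_, rfl⟩
  have hp' : p + √(n : ℝ) • M.adjoint h = D.adjoint e := by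
    rw [← hp, hh, map_smul, smul_smul, ← mul_assoc, Real.mul_self_sqrt n.cast_nonneg]
  obtain ⟨g, hg⟩ := exists_seq_adjoint_finVec hR φ h
  have hgauss := isGaussianFamily_residual (τ := τ) hμ hP hM hn hp' hg
  have hlaw : HasLaw (fun s => ⟪e, s.1⟫ - limEval g (√(n : ℝ) • dataOf φ K n s))
      (gaussianReal 0 (‖WithLp.toLp 2 (τ • p, -h)‖₊ ^ 2)) ((prior μ τ).prod P) := by
    simpa using hgauss (0, 1)
  have hind : IndepFun (fun s => ⟪e, s.1⟫ - limEval g (√(n : ℝ) • dataOf φ K n s))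
      (dataOf φ K n) ((prior μ τ).prod P) := by
    simpa [pairEval_dataOf] using hgauss.indepFun_of_inner_eq_zero (g := (0, 1))
      (v := fun k => ((K.adjoint (φ k), Finsupp.single k (√(n : ℝ))⁻¹), 0))
      fun k => by simpa using inner_residual_dataOf hn hM hh k
  have hjoint : HasLaw (fun s : X × (ℕ → ℝ) => (s.1, dataOf φ K n s))
      (prior μ τ ⊗ₘ likelihood φ K P n) ((prior μ τ).prod P) :=
    ⟨(measurable_fst.prodMk (measurable_dataOf φ K n)).aemeasurable,
      (compProd_likelihood φ K n (prior μ τ) P).symm⟩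
  have hmse := lintegral_posterior_sub_sq (f := fun u => ⟪e, u⟫)
    (F := fun y => limEval g (√(n : ℝ) • y)) (by fun_prop)
    ((measurable_limEval g).comp (measurable_const_smul _)) hjoint hlaw hind
    (ρ := likelihood φ K P n (D z)) (likelihood_absolutelyContinuous hR hP hn hrange
      ⟨M z, DFunLike.congr_fun hM z⟩) ⟪e, D z⟫
  rw [posteriorLaw, hmse, lintegral_posteriorMean_sub_sq hP hM hn hp' hg,
    ← ENNReal.ofReal_coe_nnreal, ← ENNReal.ofReal_add (by positivity) (by positivity)]
  push_cast
  rw [norm_residual_sq hh hp']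
  exact ENNReal.ofReal_le_ofReal (by linarith [norm_sq_le_of_residual hh hp'])

end Model

/-! ### Diagonal operators and the whitened forward map -/

section Diagonal

variable {ι X : Type*} [NormedAddCommGroup X] [InnerProductSpace ℝ X]

theorem hasSum_inner_mul (φ : HilbertBasis ι ℝ X) (x y : X) :
    HasSum (fun k => ⟪φ k, x⟫ * ⟪φ k, y⟫) ⟪x, y⟫ := by
  simpa only [real_inner_comm] using φ.hasSum_inner_mul_inner x y

theorem hasSum_inner_sq (φ : HilbertBasis ι ℝ X) (x : X) :
    HasSum (fun k => ⟪φ k, x⟫ ^ 2) (‖x‖ ^ 2) := by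
  simpa only [sq, real_inner_self_eq_norm_mul_norm] using hasSum_inner_mul φ x x

theorem summable_mul_inner_sq (φ : HilbertBasis ι ℝ X) {a : ι → ℝ} {b : ℝ} (ha : ∀ k, 0 ≤ a k)
    (hab : ∀ k, a k ≤ b) (x : X) : Summable fun k => a k * ⟪φ k, x⟫ ^ 2 :=
  ((hasSum_inner_sq φ x).summable.mul_left b).of_nonneg_of_le
    (fun k => mul_nonneg (ha k) (sq_nonneg _))
    fun k => mul_le_mul_of_nonneg_right (hab k) (sq_nonneg _)

theorem ext_inner_basis (φ : HilbertBasis ι ℝ X) {x y : X} (h : ∀ k, ⟪φ k, x⟫ = ⟪φ k, y⟫) :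
    x = y :=
  φ.repr.injective <| lp.ext <| funext fun k => by simpa only [φ.repr_apply_apply] using h k

/-- The operator `D` is diagonal in the basis `φ`, with diagonal `d`. -/
def IsDiagonal (φ : HilbertBasis ι ℝ X) (d : ι → ℝ) (D : X →L[ℝ] X) : Prop :=
  ∀ k x, ⟪φ k, D x⟫ = d k * ⟪φ k, x⟫

theorem exists_isDiagonal (φ : HilbertBasis ι ℝ X) {d : ι → ℝ} {b : ℝ} (hb : 0 ≤ b)
    (hd : ∀ k, |d k| ≤ b) : ∃ D, IsDiagonal φ d D := by
  have hT : ∀ k, ‖d k • ContinuousLinearMap.id ℝ ℝ‖ ≤ b := fun k => by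
    simpa [norm_smul] using hd k
  refine ⟨φ.repr.symm.toContinuousLinearEquiv.toContinuousLinearMap ∘L
    lp.mapCLM 2 (fun k => d k • ContinuousLinearMap.id ℝ ℝ) hb hT ∘L
    φ.repr.toContinuousLinearEquiv.toContinuousLinearMap, fun k x => ?_⟩
  rw [← φ.repr_apply_apply, ← φ.repr_apply_apply]
  simp [lp.mapCLM]

variable {φ : HilbertBasis ι ℝ X} {d : ι → ℝ} {D : X →L[ℝ] X}

theorem IsDiagonal.apply_basis (hD : IsDiagonal φ d D) (k : ι) : D (φ k) = d k • φ k := by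
  refine ext_inner_basis φ fun j => ?_
  rw [hD, inner_smul_right]
  rcases eq_or_ne j k with rfl | h
  · rfl
  · simp [φ.orthonormal.2 h]

theorem IsDiagonal.adjoint_eq [CompleteSpace X] (hD : IsDiagonal φ d D) : D.adjoint = D := by
  refine ((ContinuousLinearMap.eq_adjoint_iff D D).2 fun x y => ?_).symm
  refine (hasSum_inner_mul φ (D x) y).unique ((hasSum_inner_mul φ x (D y)).congr_fun fun k => ?_)
  rw [hD, hD]
  ring

theorem IsDiagonal.comp_adjoint_eq [CompleteSpace X] (hD : IsDiagonal φ d D) {C : X →L[ℝ] X}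
    (hC : ∀ k, C (φ k) = d k ^ 2 • φ k) : D ∘L D.adjoint = C := by
  refine ContinuousLinearMap.ext_on (s := Set.range φ)
    (Submodule.dense_iff_topologicalClosure_eq_top.2 φ.dense_span) ?_
  rintro _ ⟨k, rfl⟩
  rw [hD.adjoint_eq, ContinuousLinearMap.comp_apply, hD.apply_basis, map_smul, hD.apply_basis,
    smul_smul, ← sq, hC]

end Diagonal

theorem exists_comp_eq_of_injective {𝕜 E F G : Type*} [NontriviallyNormedField 𝕜]
    [NormedAddCommGroup E] [NormedSpace 𝕜 E] [CompleteSpace E] [NormedAddCommGroup F]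
    [NormedSpace 𝕜 F] [CompleteSpace F] [NormedAddCommGroup G] [NormedSpace 𝕜 G] {R : F →L[𝕜] G}
    (hR : Function.Injective R) {T : E →L[𝕜] G} (hT : ∀ x, ∃ w, R w = T x) :
    ∃ M : E →L[𝕜] F, R ∘L M = T := by
  choose m hm using hT
  let M : E →ₗ[𝕜] F :=
    { toFun := m
      map_add' := fun x y => hR (by simp only [hm, map_add])
      map_smul' := fun a x => hR (by simp only [hm, map_smul, RingHom.id_apply]) }
  have hgraph : (M.graph : Set (E × F)) = {p | R p.2 = T p.1} := by
    ext p
    rw [SetLike.mem_coe, LinearMap.mem_graph_iff, Set.mem_ofPred_eq, ← hm, hR.eq_iff]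
    rfl
  have hclosed : IsClosed (M.graph : Set (E × F)) :=
    hgraph ▸ isClosed_eq (by fun_prop) (by fun_prop)
  exact ⟨.ofIsClosedGraph hclosed, ContinuousLinearMap.ext hm⟩

section Scale

variable {X : Type*} [NormedAddCommGroup X] [InnerProductSpace ℝ X] {φ : HilbertBasis ℕ ℝ X}
  {κ : ℕ → ℝ} {b : ℝ} {D : X →L[ℝ] X}

theorem IsPosDef.eigenvalue_pos [CompleteSpace X] {C : X →L[ℝ] X} (hC : IsPosDef C)
    (hφ : ∀ k, C (φ k) = κ k • φ k) (k : ℕ) : 0 < κ k := by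
  have := hC.pos (φ k) (φ.orthonormal.ne_zero k)
  rwa [hφ, real_inner_smul_left, real_inner_self_eq_norm_sq, φ.orthonormal.1 k, one_pow,
    mul_one] at this

theorem eigenvalue_le_opNorm {C : X →L[ℝ] X} (hφ : ∀ k, C (φ k) = κ k • φ k) (k : ℕ) :
    κ k ≤ ‖C‖ := by
  have := C.le_opNorm (φ k)
  rw [hφ, norm_smul, φ.orthonormal.1 k, mul_one, mul_one] at this
  exact (le_abs_self _).trans this

theorem rpow_le_mul_rpow {x s t : ℝ} (hx : 0 < x) (hxb : x ≤ b) (hst : s ≤ t) :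
    x ^ t ≤ b ^ (t - s) * x ^ s := by
  rw [← sub_add_cancel t s, Real.rpow_add hx, sub_add_cancel]
  gcongr

theorem MemScale.mono (hκ : ∀ k, 0 < κ k) (hb : ∀ k, κ k ≤ b) {s t : ℝ} (hst : s ≤ t) {u : X}
    (h : MemScale φ κ t u) : MemScale φ κ s u := by
  refine Summable.of_nonneg_of_le (fun k => ?_) (fun k => ?_) (Summable.mul_left (b ^ (t - s)) h)
  · exact mul_nonneg (Real.rpow_nonneg (hκ k).le _) (sq_nonneg _)
  · rw [← mul_assoc, ← neg_sub_neg s t]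
    gcongr
    exact rpow_le_mul_rpow (hκ k) (hb k) (neg_le_neg hst)

theorem IsDiagonal.inner_apply_sq (hD : IsDiagonal φ (fun k => √(κ k)) D) (hκ : ∀ k, 0 < κ k)
    (k : ℕ) (z : X) : ⟪φ k, D z⟫ ^ 2 = κ k * ⟪φ k, z⟫ ^ 2 := by
  rw [hD, mul_pow, Real.sq_sqrt (hκ k).le]

theorem IsDiagonal.rpow_mul_inner_apply_sq (hD : IsDiagonal φ (fun k => √(κ k)) D)
    (hκ : ∀ k, 0 < κ k) (s : ℝ) (k : ℕ) (z : X) :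
    κ k ^ s * ⟪φ k, D z⟫ ^ 2 = κ k ^ (s + 1) * ⟪φ k, z⟫ ^ 2 := by
  rw [hD.inner_apply_sq hκ, ← mul_assoc, Real.rpow_add_one (hκ k).ne']

theorem MemScale.exists_apply_eq (hD : IsDiagonal φ (fun k => √(κ k)) D) (hκ : ∀ k, 0 < κ k)
    {u : X} (h : MemScale φ κ 1 u) : ∃ z, D z = u := by
  have hmem : Memℓp (fun k => (√(κ k))⁻¹ * ⟪φ k, u⟫) 2 := by
    rw [memℓp_gen_iff (by norm_num)]
    refine h.congr fun k => ?_
    simp [mul_pow, Real.rpow_neg_one, Real.sq_sqrt (hκ k).le]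
  refine ⟨φ.repr.symm ⟨_, hmem⟩, ext_inner_basis φ fun k => ?_⟩
  rw [hD, ← φ.repr_apply_apply, LinearIsometryEquiv.apply_symm_apply]
  exact mul_inv_cancel_left₀ (Real.sqrt_pos.2 (hκ k)).ne' _

theorem IsDiagonal.memScale (hD : IsDiagonal φ (fun k => √(κ k)) D) (hκ : ∀ k, 0 < κ k)
    (hb : ∀ k, κ k ≤ b) {s : ℝ} (hs : s ≤ 1) (z : X) : MemScale φ κ s (D z) := by
  refine MemScale.mono hκ hb hs ((hasSum_inner_sq φ z).summable.congr fun k => ?_)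
  rw [hD.rpow_mul_inner_apply_sq hκ, neg_add_cancel, Real.rpow_zero, one_mul]

variable {H : Type*} [NormedAddCommGroup H] [InnerProductSpace ℝ H] {R : H →L[ℝ] X}
  {K : X →L[ℝ] X}

/-- The whitened forward map `M = C₁^{-1/2} K C₀^{1/2}`, where `C₁ = R R*` and `C₀ = D²`. -/
theorem exists_whitened_forward [CompleteSpace X] [CompleteSpace H]
    (hR : Function.Injective R) (hD : IsDiagonal φ (fun k => √(κ k)) D)
    (hκ : ∀ k, 0 < κ k) (hb : ∀ k, κ k ≤ b) {Δ c : ℝ} (hΔ : 0 ≤ Δ) (hc : 0 < c)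
    (hfwd : ∀ u, MemScale φ κ (1 - Δ) u →
      ∃ w, R w = K u ∧ scaleNorm φ κ (1 - Δ) u ≤ c * ‖w‖) :
    ∃ M : X →L[ℝ] H, R ∘L M = K ∘L D ∧ ∀ (z : X) (s : Finset ℕ),
      ∑ k ∈ s, (c ^ 2)⁻¹ * κ k ^ Δ * ⟪φ k, z⟫ ^ 2 ≤ ‖M z‖ ^ 2 := by
  have hmem : ∀ z, MemScale φ κ (1 - Δ) (D z) := hD.memScale hκ hb (sub_le_self 1 hΔ)
  obtain ⟨M, hM⟩ := exists_comp_eq_of_injective hR (T := K ∘L D) fun z =>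
    (hfwd (D z) (hmem z)).imp fun _ h => h.1
  refine ⟨M, hM, fun z s => ?_⟩
  have hnorm : scaleNorm φ κ (1 - Δ) (D z) ≤ c * ‖M z‖ := by
    obtain ⟨w, hw, hle⟩ := hfwd (D z) (hmem z)
    rwa [← hR ((DFunLike.congr_fun hM z).trans hw.symm)] at hle
  have hsum : ∑ k ∈ s, κ k ^ Δ * ⟪φ k, z⟫ ^ 2 ≤ (c * ‖M z‖) ^ 2 := calc
    _ = ∑ k ∈ s, κ k ^ (-(1 - Δ)) * ⟪φ k, D z⟫ ^ 2 := by
      simp only [hD.rpow_mul_inner_apply_sq hκ, neg_sub, sub_add_cancel]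
    _ ≤ ∑' k, κ k ^ (-(1 - Δ)) * ⟪φ k, D z⟫ ^ 2 :=
      (hmem z).sum_le_tsum _ fun k _ => mul_nonneg (Real.rpow_nonneg (hκ k).le _) (sq_nonneg _)
    _ ≤ (c * ‖M z‖) ^ 2 := (Real.sqrt_le_left (by positivity)).1 hnorm
  rwa [mul_pow, ← inv_mul_le_iff₀ (by positivity), Finset.mul_sum, ← Finset.sum_congr rfl
    fun k _ => mul_assoc _ _ _] at hsum

end Scale

/-! ### Resolvent bounds for `1 + t M* M` -/

section Resolvent

variable {ι E F : Type*} [NormedAddCommGroup E] [InnerProductSpace ℝ E] [CompleteSpace E]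
  [NormedAddCommGroup F] [InnerProductSpace ℝ F] [CompleteSpace F] {M : E →L[ℝ] F} {t : ℝ}
  {p e x z : E}

theorem inner_of_add_smul_adjoint_eq (hx : x + t • M.adjoint (M x) = z) :
    ⟪z, x⟫ = ‖x‖ ^ 2 + t * ‖M x‖ ^ 2 := by
  rw [← hx, inner_add_left, real_inner_smul_left, M.adjoint_inner_left,
    real_inner_self_eq_norm_sq, real_inner_self_eq_norm_sq]

theorem inner_comm_of_add_smul_adjoint_eq (hp : p + t • M.adjoint (M p) = e)
    (hx : x + t • M.adjoint (M x) = z) : ⟪p, z⟫ = ⟪e, x⟫ := by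
  rw [← hx, ← hp, inner_add_right, inner_add_left, real_inner_smul_left, real_inner_smul_right,
    M.adjoint_inner_left, M.adjoint_inner_right]

theorem exists_add_smul_adjoint_eq (M : E →L[ℝ] F) (ht : 0 ≤ t) (z : E) :
    ∃ x, x + t • M.adjoint (M x) = z := by
  have hunit : IsUnit (ContinuousLinearMap.id ℝ E + t • (M.adjoint ∘L M)) := by
    refine ContinuousLinearMap.isUnit_of_forall_le_norm_inner_map _ (c := 1) one_pos fun x => ?_
    change ‖x‖ ^ 2 * 1 ≤ ‖⟪x + t • M.adjoint (M x), x⟫‖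
    rw [inner_of_add_smul_adjoint_eq rfl, mul_one, Real.norm_of_nonneg (by positivity)]
    exact le_add_of_nonneg_right (by positivity)
  exact (ContinuousLinearMap.isUnit_iff_bijective.1 hunit).2 z

theorem sum_one_add_mul_inner_sq_le {v : ι → E} (hv : Orthonormal ℝ v) (ht : 0 ≤ t) {a : ι → ℝ}
    {s : Finset ι} (hM : ∑ k ∈ s, a k * ⟪v k, x⟫ ^ 2 ≤ ‖M x‖ ^ 2)
    (hx : x + t • M.adjoint (M x) = z) : ∑ k ∈ s, (1 + t * a k) * ⟪v k, x⟫ ^ 2 ≤ ⟪z, x⟫ := by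
  have hbessel : ∑ k ∈ s, ⟪v k, x⟫ ^ 2 ≤ ‖x‖ ^ 2 := by
    simpa only [Real.norm_eq_abs, sq_abs] using hv.sum_inner_products_le x (s := s)
  simp only [add_mul, one_mul, Finset.sum_add_distrib, mul_assoc]
  rw [← Finset.mul_sum, inner_of_add_smul_adjoint_eq hx]
  gcongr

theorem inner_le_inv_one_add_mul {v : ι → E} (hv : Orthonormal ℝ v) (ht : 0 ≤ t) {b : ℝ}
    (hb : 0 ≤ b) {k : ι} (hM : b * ⟪v k, p⟫ ^ 2 ≤ ‖M p‖ ^ 2)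
    (hp : p + t • M.adjoint (M p) = v k) : ⟪v k, p⟫ ≤ (1 + t * b)⁻¹ := by
  have henergy : (1 + t * b) * ⟪v k, p⟫ ^ 2 ≤ ⟪v k, p⟫ := by
    simpa using sum_one_add_mul_inner_sq_le hv ht (a := fun _ => b) (s := {k}) (by simpa) hp
  have hpos : 0 < 1 + t * b := by positivity
  rw [← one_div, le_div_iff₀' hpos]
  rcases le_or_gt ⟪v k, p⟫ 0 with h | h
  · exact (mul_nonpos_of_nonneg_of_nonpos hpos.le h).trans zero_le_one
  · rwa [sq, ← mul_assoc, mul_le_iff_le_one_left h] at henergy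

variable {φ : HilbertBasis ι ℝ E} {a : ι → ℝ}

theorem summable_one_add_mul_inner_sq (ht : 0 ≤ t) (ha : ∀ k, 0 ≤ a k)
    (hM : ∀ s : Finset ι, ∑ k ∈ s, a k * ⟪φ k, x⟫ ^ 2 ≤ ‖M x‖ ^ 2)
    (hx : x + t • M.adjoint (M x) = z) : Summable fun k => (1 + t * a k) * ⟪φ k, x⟫ ^ 2 :=
  summable_of_sum_le
    (fun k => mul_nonneg (add_nonneg zero_le_one (mul_nonneg ht (ha k))) (sq_nonneg _))
    fun s => sum_one_add_mul_inner_sq_le φ.orthonormal ht (hM s) hx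

theorem tsum_one_add_mul_inner_sq_le (ht : 0 ≤ t) (ha : ∀ k, 0 ≤ a k)
    (hM : ∀ s : Finset ι, ∑ k ∈ s, a k * ⟪φ k, x⟫ ^ 2 ≤ ‖M x‖ ^ 2)
    (hx : x + t • M.adjoint (M x) = z) :
    ∑' k, (1 + t * a k) * ⟪φ k, x⟫ ^ 2 ≤ ∑' k, (1 + t * a k)⁻¹ * ⟪φ k, z⟫ ^ 2 := by
  have hsumx := summable_one_add_mul_inner_sq ht ha hM hx
  have hsumz : Summable fun k => (1 + t * a k)⁻¹ * ⟪φ k, z⟫ ^ 2 :=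
    summable_mul_inner_sq φ (fun k => by have := ha k; positivity)
      (fun k => inv_le_one_of_one_le₀ (le_add_of_nonneg_right (mul_nonneg ht (ha k)))) z
  have henergy : ∑' k, (1 + t * a k) * ⟪φ k, x⟫ ^ 2 ≤ ⟪z, x⟫ :=
    hsumx.tsum_le_of_sum_le fun s => sum_one_add_mul_inner_sq_le φ.orthonormal ht (hM s) hx
  have hamgm : ∀ k, ⟪φ k, z⟫ * ⟪φ k, x⟫ ≤
      ((1 + t * a k) * ⟪φ k, x⟫ ^ 2 + (1 + t * a k)⁻¹ * ⟪φ k, z⟫ ^ 2) / 2 := fun k => by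
    have hpos : 0 < 1 + t * a k := by have := ha k; positivity
    have hsq : (1 + t * a k)⁻¹ * ((1 + t * a k) * ⟪φ k, x⟫ - ⟪φ k, z⟫) ^ 2 =
        (1 + t * a k) * ⟪φ k, x⟫ ^ 2 + (1 + t * a k)⁻¹ * ⟪φ k, z⟫ ^ 2 -
          2 * (⟪φ k, z⟫ * ⟪φ k, x⟫) := by
      field_simp
      ring
    have : 0 ≤ (1 + t * a k)⁻¹ * ((1 + t * a k) * ⟪φ k, x⟫ - ⟪φ k, z⟫) ^ 2 := by positivity
    linarith
  have hle := hasSum_le hamgm (hasSum_inner_mul φ z x)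
    ((hsumx.hasSum.add hsumz.hasSum).div_const 2)
  linarith

theorem mul_rpow_le_one_add {y θ : ℝ} (hy : 0 ≤ y) (hθ : θ ∈ Set.Icc 0 1) :
    y ^ θ ≤ 1 + y := by
  rcases le_total y 1 with h | h
  · exact (Real.rpow_le_one hy h hθ.1).trans (le_add_of_nonneg_right hy)
  · exact (Real.rpow_le_self_of_one_le h hθ.2).trans (le_add_of_nonneg_left zero_le_one)

theorem rpow_le_rpow_neg_mul_one_add {b θ : ℝ} (ht : 0 < t) (hb : 0 ≤ b)
    (hθ : θ ∈ Set.Icc 0 1) : b ^ θ ≤ t ^ (-θ) * (1 + t * b) := by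
  rw [Real.rpow_neg ht.le, le_inv_mul_iff₀ (by positivity), ← Real.mul_rpow ht.le hb]
  exact mul_rpow_le_one_add (by positivity) hθ

theorem inv_one_add_mul_le {b θ : ℝ} (ht : 0 < t) (hb : 0 < b) (hθ : θ ∈ Set.Icc 0 1) :
    (1 + t * b)⁻¹ ≤ t ^ (-θ) * b ^ (-θ) := by
  rw [← Real.mul_rpow ht.le hb.le, Real.rpow_neg (by positivity)]
  exact inv_anti₀ (by positivity) (mul_rpow_le_one_add (by positivity) hθ)

theorem summable_rpow_mul_inner_sq (ht : 0 < t) (ha : ∀ k, 0 ≤ a k)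
    (hM : ∀ s : Finset ι, ∑ k ∈ s, a k * ⟪φ k, x⟫ ^ 2 ≤ ‖M x‖ ^ 2)
    (hx : x + t • M.adjoint (M x) = z) {θ : ℝ} (hθ : θ ∈ Set.Icc 0 1) :
    Summable fun k => a k ^ θ * ⟪φ k, x⟫ ^ 2 := by
  refine ((summable_one_add_mul_inner_sq ht.le ha hM hx).mul_left (t ^ (-θ))).of_nonneg_of_le
    (fun k => mul_nonneg (Real.rpow_nonneg (ha k) _) (sq_nonneg _)) fun k => ?_
  rw [← mul_assoc]
  gcongr
  exact rpow_le_rpow_neg_mul_one_add ht (ha k) hθ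

theorem tsum_rpow_mul_inner_sq_le (ht : 0 < t) (ha : ∀ k, 0 < a k)
    (hM : ∀ s : Finset ι, ∑ k ∈ s, a k * ⟪φ k, x⟫ ^ 2 ≤ ‖M x‖ ^ 2)
    (hx : x + t • M.adjoint (M x) = z) {θ θ' : ℝ} (hθ : θ ∈ Set.Icc 0 1)
    (hθ' : θ' ∈ Set.Icc 0 1) (hz : Summable fun k => a k ^ (-θ') * ⟪φ k, z⟫ ^ 2) :
    ∑' k, a k ^ θ * ⟪φ k, x⟫ ^ 2 ≤
      t ^ (-(θ + θ')) * ∑' k, a k ^ (-θ') * ⟪φ k, z⟫ ^ 2 := by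
  have ha' := fun k => (ha k).le
  have hsumx := summable_one_add_mul_inner_sq ht.le ha' hM hx
  have hz_le : ∀ k, (1 + t * a k)⁻¹ * ⟪φ k, z⟫ ^ 2 ≤
      t ^ (-θ') * (a k ^ (-θ') * ⟪φ k, z⟫ ^ 2) := fun k => by
    rw [← mul_assoc]
    gcongr
    exact inv_one_add_mul_le ht (ha k) hθ'
  calc ∑' k, a k ^ θ * ⟪φ k, x⟫ ^ 2
      ≤ ∑' k, t ^ (-θ) * ((1 + t * a k) * ⟪φ k, x⟫ ^ 2) :=
        (summable_rpow_mul_inner_sq ht ha' hM hx hθ).tsum_le_tsum (fun k => by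
          rw [← mul_assoc]
          gcongr
          exact rpow_le_rpow_neg_mul_one_add ht (ha' k) hθ) (hsumx.mul_left _)
    _ = t ^ (-θ) * ∑' k, (1 + t * a k) * ⟪φ k, x⟫ ^ 2 := tsum_mul_left
    _ ≤ t ^ (-θ) * ∑' k, t ^ (-θ') * (a k ^ (-θ') * ⟪φ k, z⟫ ^ 2) := by
        refine mul_le_mul_of_nonneg_left ?_ (by positivity)
        exact (tsum_one_add_mul_inner_sq_le ht.le ha' hM hx).trans <|
          ((hz.mul_left _).of_nonneg_of_le (fun k => by have := ha k; positivity)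
            hz_le).tsum_le_tsum hz_le (hz.mul_left _)
    _ = t ^ (-(θ + θ')) * ∑' k, a k ^ (-θ') * ⟪φ k, z⟫ ^ 2 := by
        rw [tsum_mul_left, ← mul_assoc, ← Real.rpow_add ht, neg_add]

end Resolvent

/-! ### The posterior mean square error -/

theorem lintegral_measure_norm_sub_ge_le {X γ : Type*} [SeminormedAddCommGroup X]
    [MeasurableSpace X] [OpensMeasurableSpace X] [MeasurableSpace γ] (η : Kernel γ X)
    (ρ : Measure γ) (w : X) {r : ℝ} (hr : 0 < r) :
    ∫⁻ y, η y {u | r ≤ ‖u - w‖} ∂ρ ≤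
      (∫⁻ y, ∫⁻ u, ENNReal.ofReal (‖u - w‖ ^ 2) ∂(η y) ∂ρ) / ENNReal.ofReal (r ^ 2) := by
  have hr2 : ENNReal.ofReal (r ^ 2) ≠ 0 := (ENNReal.ofReal_pos.2 (by positivity)).ne'
  have hmarkov : ∀ y, η y {u | r ≤ ‖u - w‖} ≤
      (ENNReal.ofReal (r ^ 2))⁻¹ * ∫⁻ u, ENNReal.ofReal (‖u - w‖ ^ 2) ∂(η y) := fun y => by
    rw [← ENNReal.div_eq_inv_mul]
    refine (measure_mono fun u hu => ?_).trans <|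
      meas_ge_le_lintegral_div (Continuous.measurable (by fun_prop)).ennreal_ofReal.aemeasurable hr2
        ENNReal.ofReal_ne_top
    exact ENNReal.ofReal_le_ofReal (pow_le_pow_left₀ hr.le hu 2)
  refine (lintegral_mono hmarkov).trans_eq ?_
  rw [lintegral_const_mul' _ _ (ENNReal.inv_ne_top.2 hr2), ENNReal.div_eq_inv_mul]

section MeanSquareError

variable {X : Type*} [NormedAddCommGroup X] [InnerProductSpace ℝ X] [SecondCountableTopology X]
  [MeasurableSpace X] [BorelSpace X]

theorem lintegral_lintegral_norm_sub_sq {ι γ : Type*} [Countable ι] [MeasurableSpace γ]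
    (φ : HilbertBasis ι ℝ X) (η : Kernel γ X) (ρ : Measure γ) (w : X) :
    ∫⁻ y, ∫⁻ u, ENNReal.ofReal (‖u - w‖ ^ 2) ∂(η y) ∂ρ =
      ∑' k, ∫⁻ y, ∫⁻ u, ENNReal.ofReal ((⟪φ k, u⟫ - ⟪φ k, w⟫) ^ 2) ∂(η y) ∂ρ := by
  have hcoord : ∀ u : X, ENNReal.ofReal (‖u - w‖ ^ 2) =
      ∑' k, ENNReal.ofReal ((⟪φ k, u⟫ - ⟪φ k, w⟫) ^ 2) := fun u => by
    have hsum := hasSum_inner_sq φ (u - w)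
    simp only [inner_sub_right] at hsum
    rw [← hsum.tsum_eq, ENNReal.ofReal_tsum_of_nonneg (fun k => sq_nonneg _) hsum.summable]
  have hmeas : ∀ k, Measurable fun u : X =>
      ENNReal.ofReal ((⟪φ k, u⟫ - ⟪φ k, w⟫) ^ 2) := fun k => by fun_prop
  simp only [hcoord, lintegral_tsum fun k => (hmeas k).aemeasurable]
  exact lintegral_tsum fun k => (hmeas k).lintegral_kernel.aemeasurable

variable [CompleteSpace X]
  {H : Type*} [NormedAddCommGroup H] [InnerProductSpace ℝ H] [CompleteSpace H]
  {φ : HilbertBasis ℕ ℝ X} {κ a : ℕ → ℝ} {D K : X →L[ℝ] X} {R : H →L[ℝ] X} {M : X →L[ℝ] H}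
  {μ : Measure X} {τ : ℝ}

theorem lintegral_inner_sq_prior (hμ : IsCenteredGaussian μ (D ∘L D.adjoint)) (τ : ℝ) (x : X) :
    ∫⁻ u, ENNReal.ofReal (⟪x, u⟫ ^ 2) ∂(prior μ τ) =
      ENNReal.ofReal (τ ^ 2 * ‖D.adjoint x‖ ^ 2) := by
  have hlaw := (hasLaw_inner_prior hμ τ x).lintegral_comp
    (f := fun r => ENNReal.ofReal ((r + 0) ^ 2)) (by fun_prop)
  rw [lintegral_add_const_sq_gaussianReal] at hlaw
  simpa [norm_smul, mul_pow] using hlaw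

theorem ae_memScale_prior (hμ : IsCenteredGaussian μ (D ∘L D.adjoint))
    (hD : IsDiagonal φ (fun k => √(κ k)) D) (hκ : ∀ k, 0 < κ k) {s : ℝ}
    (hs : Summable fun k => κ k ^ (1 - s)) (τ : ℝ) : ∀ᵐ u ∂(prior μ τ), MemScale φ κ s u := by
  have hpow : ∀ k, 0 ≤ κ k ^ (-s) := fun k => Real.rpow_nonneg (hκ k).le _
  have hmeas : ∀ k, Measurable fun u : X => ENNReal.ofReal (κ k ^ (-s) * ⟪φ k, u⟫ ^ 2) :=
    fun k => by fun_prop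
  have hterm : ∀ k, ∫⁻ u, ENNReal.ofReal (κ k ^ (-s) * ⟪φ k, u⟫ ^ 2) ∂(prior μ τ) =
      ENNReal.ofReal (τ ^ 2 * κ k ^ (1 - s)) := fun k => by
    simp_rw [ENNReal.ofReal_mul (hpow k)]
    rw [lintegral_const_mul _ (by fun_prop), lintegral_inner_sq_prior hμ, hD.adjoint_eq,
      hD.apply_basis, norm_smul, φ.orthonormal.1 k, mul_one, Real.norm_eq_abs, sq_abs,
      Real.sq_sqrt (hκ k).le, ← ENNReal.ofReal_mul (hpow k), mul_left_comm,
      ← Real.rpow_add_one (hκ k).ne', neg_add_eq_sub]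
  have hfin : ∫⁻ u, ∑' k, ENNReal.ofReal (κ k ^ (-s) * ⟪φ k, u⟫ ^ 2) ∂(prior μ τ) ≠ ⊤ := by
    rw [lintegral_tsum fun k => (hmeas k).aemeasurable, tsum_congr hterm]
    exact (hs.mul_left _).tsum_ofReal_ne_top
  filter_upwards [ae_lt_top (Measurable.tsum hmeas) hfin] with u hu
  refine (ENNReal.summable_toReal hu.ne).congr fun k => ?_
  exact ENNReal.toReal_ofReal (mul_nonneg (hpow k) (sq_nonneg _))

variable {P : Measure (ℕ → ℝ)} [IsProbabilityMeasure P] [IsProbabilityMeasure μ] {n : ℕ}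

/-- The mean square error `E ∫ ‖u - u'‖² μ_{n,τ}^y(du)` of the posterior, under data `y` with law
`N(K u', n⁻¹ C₁)`. -/
noncomputable def meanSquareError (φ : HilbertBasis ℕ ℝ X) (K : X →L[ℝ] X) (μ : Measure X)
    [IsProbabilityMeasure μ] (P : Measure (ℕ → ℝ)) [IsProbabilityMeasure P] (n : ℕ) (τ : ℝ)
    (u' : X) : ENNReal :=
  ∫⁻ y, ∫⁻ u, ENNReal.ofReal (‖u - u'‖ ^ 2) ∂(posteriorLaw φ K μ P n τ y) ∂(likelihood φ K P n u')

theorem lintegral_posterior_inner_basis_sub_sq_le (hμ : IsCenteredGaussian μ (D ∘L D.adjoint))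
    (hP : IsCenteredGaussianSeq P φ (R ∘L R.adjoint)) (hR : Function.Injective R)
    (hrange : ∀ᵐ u ∂(prior μ τ), ∃ w, R w = K u) (hRM : R ∘L M = K ∘L D)
    (hD : IsDiagonal φ (fun k => √(κ k)) D) (hκ : ∀ k, 0 < κ k) (hn : n ≠ 0) (hτ : 0 < τ)
    {k : ℕ} {b : ℝ} (hb : 0 < b) (hM : ∀ x, b * ⟪φ k, x⟫ ^ 2 ≤ ‖M x‖ ^ 2) {ϑ : ℝ}
    (hϑ : ϑ ∈ Set.Icc 0 1) {x z : X} (hx : x + (n * τ ^ 2 : ℝ) • M.adjoint (M x) = z) :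
    ∫⁻ y, ∫⁻ u, ENNReal.ofReal ((⟪φ k, u⟫ - ⟪φ k, D z⟫) ^ 2) ∂(posteriorLaw φ K μ P n τ y)
        ∂(likelihood φ K P n (D z)) ≤
      ENNReal.ofReal (2 * τ ^ 2 * (n * τ ^ 2) ^ (-ϑ) * (κ k * b ^ (-ϑ)) +
        κ k * ⟪φ k, x⟫ ^ 2) := by
  have ht : 0 < n * τ ^ 2 := by positivity
  obtain ⟨q, hq⟩ := exists_add_smul_adjoint_eq M ht.le (φ k)
  have hp : √(κ k) • q + (n * τ ^ 2 : ℝ) • M.adjoint (M (√(κ k) • q)) = D.adjoint (φ k) := by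
    rw [hD.adjoint_eq, hD.apply_basis, ← hq, smul_add, map_smul, map_smul, smul_comm]
  have hvariance : ⟪φ k, q⟫ ≤ (n * τ ^ 2) ^ (-ϑ) * b ^ (-ϑ) :=
    (inner_le_inv_one_add_mul φ.orthonormal ht.le hb.le (hM q) hq).trans
      (inv_one_add_mul_le ht hb hϑ)
  refine (lintegral_posterior_inner_sub_sq_le hμ hP hRM hn hR hrange hp z).trans
    (ENNReal.ofReal_le_ofReal ?_)
  rw [hD.adjoint_eq, hD.apply_basis, real_inner_smul_left, real_inner_smul_left,
    real_inner_smul_right, inner_comm_of_add_smul_adjoint_eq hq hx, ← mul_assoc √(κ k),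
    Real.mul_self_sqrt (hκ k).le, mul_pow, Real.sq_sqrt (hκ k).le]
  have := mul_le_mul_of_nonneg_left hvariance (mul_nonneg (sq_nonneg τ) (hκ k).le)
  linarith

/-- The two terms bound the posterior variance and the squared bias. -/
theorem meanSquareError_le (hμ : IsCenteredGaussian μ (D ∘L D.adjoint))
    (hP : IsCenteredGaussianSeq P φ (R ∘L R.adjoint)) (hR : Function.Injective R)
    (hrange : ∀ᵐ u ∂(prior μ τ), ∃ w, R w = K u) (hRM : R ∘L M = K ∘L D)
    (hD : IsDiagonal φ (fun k => √(κ k)) D) (hκ : ∀ k, 0 < κ k) (hn : n ≠ 0) (hτ : 0 < τ)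
    (ha : ∀ k, 0 < a k)
    (hM : ∀ x (s : Finset ℕ), ∑ k ∈ s, a k * ⟪φ k, x⟫ ^ 2 ≤ ‖M x‖ ^ 2)
    {ϑ : ℝ} (hϑ : ϑ ∈ Set.Icc 0 1) (hvar : Summable fun k => κ k * a k ^ (-ϑ))
    {θ : ℝ} (hθ : θ ∈ Set.Icc 0 1) {L : ℝ} (hL : 0 ≤ L) (hκa : ∀ k, κ k ≤ L * a k ^ θ)
    {θ' : ℝ} (hθ' : θ' ∈ Set.Icc 0 1) {z : X}
    (hz : Summable fun k => a k ^ (-θ') * ⟪φ k, z⟫ ^ 2) :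
    meanSquareError φ K μ P n τ (D z) ≤
      ENNReal.ofReal (2 * τ ^ 2 * (n * τ ^ 2) ^ (-ϑ) * ∑' k, κ k * a k ^ (-ϑ) +
        L * ((n * τ ^ 2) ^ (-(θ + θ')) * ∑' k, a k ^ (-θ') * ⟪φ k, z⟫ ^ 2)) := by
  have ht : 0 < n * τ ^ 2 := by positivity
  obtain ⟨x, hx⟩ := exists_add_smul_adjoint_eq M ht.le z
  have hbias_le : ∀ k, κ k * ⟪φ k, x⟫ ^ 2 ≤ L * (a k ^ θ * ⟪φ k, x⟫ ^ 2) := fun k => by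
    rw [← mul_assoc]
    exact mul_le_mul_of_nonneg_right (hκa k) (sq_nonneg _)
  have hsum_bias := (summable_rpow_mul_inner_sq ht (fun k => (ha k).le) (hM x) hx hθ).mul_left L
  have hbias := (hsum_bias.of_nonneg_of_le (fun k => mul_nonneg (hκ k).le (sq_nonneg _)) hbias_le)
  have hterm := fun k => lintegral_posterior_inner_basis_sub_sq_le hμ hP hR hrange hRM hD hκ hn hτ
    (ha k) (fun y => by simpa using hM y {k}) hϑ hx
  have hsum := (hvar.hasSum.mul_left (2 * τ ^ 2 * (n * τ ^ 2) ^ (-ϑ))).add hbias.hasSum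
  rw [meanSquareError, lintegral_lintegral_norm_sub_sq φ]
  refine (ENNReal.tsum_le_tsum hterm).trans ?_
  rw [← ENNReal.ofReal_tsum_of_nonneg (fun k => ?_) hsum.summable, hsum.tsum_eq]
  · refine ENNReal.ofReal_le_ofReal (add_le_add_right ?_ _)
    calc ∑' k, κ k * ⟪φ k, x⟫ ^ 2
        ≤ ∑' k, L * (a k ^ θ * ⟪φ k, x⟫ ^ 2) := hbias.tsum_le_tsum hbias_le hsum_bias
      _ = L * ∑' k, a k ^ θ * ⟪φ k, x⟫ ^ 2 := tsum_mul_left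
      _ ≤ _ := by
        gcongr
        exact tsum_rpow_mul_inner_sq_le ht ha (hM x) hx hθ hθ' hz
  · have := hκ k
    have := ha k
    positivity

theorem posteriorContracts_of_meanSquareError_le {u' : X} {τ r : ℕ → ℝ} {A : ℝ}
    (hr : ∀ n, n ≠ 0 → 0 < r n)
    (hmse : ∀ n, n ≠ 0 → meanSquareError φ K μ P n (τ n) u' ≤ ENNReal.ofReal (A * r n ^ 2)) :
    PosteriorContracts φ K μ P u' τ r := by
  intro M hM
  have hlim : Tendsto (fun n => ENNReal.ofReal (A / M n ^ 2)) atTop (𝓝 0) := by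
    simpa using ENNReal.tendsto_ofReal
      (tendsto_const_nhds.div_atTop ((tendsto_pow_atTop two_ne_zero).comp hM))
  refine tendsto_of_tendsto_of_tendsto_of_le_of_le' tendsto_const_nhds hlim
    (Eventually.of_forall fun n => zero_le) ?_
  filter_upwards [hM.eventually_gt_atTop 0, eventually_ne_atTop 0] with n hMn hn
  have hrn := hr n hn
  have hpos : 0 < (M n * r n) ^ 2 := by positivity
  calc _ ≤ _ := lintegral_measure_norm_sub_ge_le _ _ u' (mul_pos hMn hrn)
    _ ≤ ENNReal.ofReal (A * r n ^ 2) / ENNReal.ofReal ((M n * r n) ^ 2) := by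
      gcongr
      exact hmse n hn
    _ = ENNReal.ofReal (A / M n ^ 2) := by
      rw [← ENNReal.ofReal_div_of_pos hpos, mul_pow, mul_div_mul_right _ _ (by positivity)]

end MeanSquareError

/-! ### Rates -/

section Rates

variable {X H : Type*} [NormedAddCommGroup X] [InnerProductSpace ℝ X] [CompleteSpace X]
  [SecondCountableTopology X] [MeasurableSpace X] [BorelSpace X] [NormedAddCommGroup H]
  [InnerProductSpace ℝ H] [CompleteSpace H] {C₀ D K : X →L[ℝ] X} {R : H →L[ℝ] X} {M : X →L[ℝ] H}
  {φ : HilbertBasis ℕ ℝ X} {κ : ℕ → ℝ} {μ : Measure X} [IsProbabilityMeasure μ]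
  {P : Measure (ℕ → ℝ)} [IsProbabilityMeasure P] {Δ γ q v : ℝ} {u' z : X}

theorem mul_rpow_rpow_div {w x : ℝ} (hw : 0 ≤ w) (hx : 0 ≤ x) (hΔ : Δ ≠ 0) (y : ℝ) :
    (w * x ^ Δ) ^ (y / Δ) = w ^ (y / Δ) * x ^ y := by
  rw [Real.mul_rpow hw (Real.rpow_nonneg hx _), ← Real.rpow_mul hx, mul_div_cancel₀ _ hΔ]

theorem exists_meanSquareError_le_of_le_norm_sq (hμ : IsCenteredGaussian μ (D ∘L D.adjoint))
    (hP : IsCenteredGaussianSeq P φ (R ∘L R.adjoint)) (hR : Function.Injective R)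
    (hrange : ∀ τ, ∀ᵐ u ∂(prior μ τ), ∃ w, R w = K u) (hRM : R ∘L M = K ∘L D)
    (hD : IsDiagonal φ (fun k => √(κ k)) D) (hκ : ∀ k, 0 < κ k) {b : ℝ} (hb : ∀ k, κ k ≤ b)
    (hΔ : 0 < Δ) {w : ℝ} (hw : 0 < w)
    (hM : ∀ x (s : Finset ℕ), ∑ k ∈ s, w * κ k ^ Δ * ⟪φ k, x⟫ ^ 2 ≤ ‖M x‖ ^ 2)
    (hq : q ∈ Set.Icc 0 1) (hqΔ : q ≤ Δ) (hv : v ∈ Set.Icc 0 Δ)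
    (hvs : Summable fun k => κ k ^ (1 - v)) (hγ : γ ∈ Set.Icc 1 (Δ + 1))
    (hz : MemScale φ κ γ (D z)) :
    ∃ A ≥ 0, ∃ B, ∀ n : ℕ, n ≠ 0 → ∀ τ : ℝ, 0 < τ → meanSquareError φ K μ P n τ (D z) ≤
      ENNReal.ofReal (A * (τ ^ 2 * (n * τ ^ 2) ^ (-(v / Δ))) +
        B * (n * τ ^ 2) ^ (-((q + γ - 1) / Δ))) := by
  set a : ℕ → ℝ := fun k => w * κ k ^ Δ
  have ha₀ : ∀ k, 0 < a k := fun k => mul_pos hw (Real.rpow_pos_of_pos (hκ k) _)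
  have ha : ∀ k y, a k ^ (y / Δ) = w ^ (y / Δ) * κ k ^ y := fun k =>
    mul_rpow_rpow_div hw.le (hκ k).le hΔ.ne'
  have hb₀ : 0 ≤ b := (hκ 0).le.trans (hb 0)
  have hvar : Summable fun k => κ k * a k ^ (-(v / Δ)) :=
    (hvs.mul_left (w ^ (-v / Δ))).congr fun k => by
      rw [← neg_div, ha, mul_left_comm, sub_eq_add_neg, Real.rpow_add (hκ k), Real.rpow_one]
  have hκa : ∀ k, κ k ≤ b ^ (1 - q) * (w ^ (q / Δ))⁻¹ * a k ^ (q / Δ) := fun k => by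
    rw [ha, mul_assoc, inv_mul_cancel_left₀ (Real.rpow_pos_of_pos hw _).ne']
    simpa using rpow_le_mul_rpow (hκ k) (hb k) hq.2
  have hza : Summable fun k => a k ^ (-((γ - 1) / Δ)) * ⟪φ k, z⟫ ^ 2 :=
    (Summable.mul_left (w ^ (-(γ - 1) / Δ)) hz).congr fun k => by
      rw [← neg_div, ha, hD.rpow_mul_inner_apply_sq hκ, mul_assoc, neg_sub, neg_add_eq_sub]
  have hdiv : ∀ y ∈ Set.Icc 0 Δ, y / Δ ∈ Set.Icc (0 : ℝ) 1 := fun y hy =>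
    ⟨div_nonneg hy.1 hΔ.le, div_le_one_of_le₀ hy.2 hΔ.le⟩
  refine ⟨2 * ∑' k, κ k * a k ^ (-(v / Δ)), ?_, b ^ (1 - q) * (w ^ (q / Δ))⁻¹ *
    ∑' k, a k ^ (-((γ - 1) / Δ)) * ⟪φ k, z⟫ ^ 2, fun n hn τ hτ => ?_⟩
  · exact mul_nonneg zero_le_two (tsum_nonneg fun k =>
      mul_nonneg (hκ k).le (Real.rpow_nonneg (ha₀ k).le _))
  refine (meanSquareError_le hμ hP hR (hrange τ) hRM hD hκ hn hτ ha₀ hM (hdiv v hv) hvar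
    (hdiv q ⟨hq.1, hqΔ⟩) (by positivity) hκa
    (hdiv (γ - 1) ⟨sub_nonneg.2 hγ.1, sub_le_iff_le_add.2 hγ.2⟩) hza).trans_eq ?_
  rw [← add_div, ← add_sub_assoc]
  ring_nf

theorem exists_meanSquareError_le (hκ : ∀ k, 0 < κ k) (hφ : ∀ k, C₀ (φ k) = κ k • φ k)
    (hμ : IsCenteredGaussian μ C₀) (hR : Function.Injective R)
    (hP : IsCenteredGaussianSeq P φ (R ∘L R.adjoint)) (hΔ : 0 < Δ)
    (hΔs : Summable fun k => κ k ^ Δ)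
    (hfwd : ∃ c > 0, ∀ u, MemScale φ κ (1 - Δ) u →
      ∃ w, R w = K u ∧ scaleNorm φ κ (1 - Δ) u ≤ c * ‖w‖)
    (hq : q ∈ Set.Icc 0 1) (hqΔ : q ≤ Δ) (hv : v ∈ Set.Icc 0 Δ)
    (hvs : Summable fun k => κ k ^ (1 - v)) (hγ : γ ∈ Set.Icc 1 (Δ + 1))
    (hu' : MemScale φ κ γ u') :
    ∃ A ≥ 0, ∃ B, ∀ n : ℕ, n ≠ 0 → ∀ τ : ℝ, 0 < τ → meanSquareError φ K μ P n τ u' ≤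
      ENNReal.ofReal (A * (τ ^ 2 * (n * τ ^ 2) ^ (-(v / Δ))) +
        B * (n * τ ^ 2) ^ (-((q + γ - 1) / Δ))) := by
  obtain ⟨c, hc, hfwd⟩ := hfwd
  have hb : ∀ k, κ k ≤ ‖C₀‖ := eigenvalue_le_opNorm hφ
  obtain ⟨D, hD⟩ := exists_isDiagonal φ (d := fun k => √(κ k)) (Real.sqrt_nonneg ‖C₀‖) fun k => by
    rw [abs_of_nonneg (Real.sqrt_nonneg _)]
    exact Real.sqrt_le_sqrt (hb k)
  obtain rfl : D ∘L D.adjoint = C₀ :=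
    hD.comp_adjoint_eq fun k => by rw [hφ, Real.sq_sqrt (hκ k).le]
  obtain ⟨M, hRM, hM⟩ := exists_whitened_forward hR hD hκ hb hΔ.le hc hfwd
  obtain ⟨z, rfl⟩ := MemScale.exists_apply_eq hD hκ (hu'.mono hκ hb hγ.1)
  have hrange : ∀ τ, ∀ᵐ u ∂(prior μ τ), ∃ w, R w = K u := fun τ => by
    filter_upwards [ae_memScale_prior hμ hD hκ (s := 1 - Δ)
      (by simpa only [sub_sub_cancel] using hΔs) τ] with u hu
    exact (hfwd u hu).imp fun _ h => h.1
  exact exists_meanSquareError_le_of_le_norm_sq hμ hP hR hrange hRM hD hκ hb hΔ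
    (by positivity : 0 < (c ^ 2)⁻¹) hM hq hqΔ hv hvs hγ hu'

/-- The choice `τ = x^{-a/(2d)}` makes `x τ² = x^{Δ/d}`, which balances the two terms as soon as
`m ≤ a + v`. -/
theorem mul_rpow_add_mul_rpow_le {x a d m A : ℝ} (B : ℝ) (hx : 1 ≤ x) (hA : 0 ≤ A) (hΔ : Δ ≠ 0)
    (hd : d = Δ + a) (hd₀ : 0 < d) (hm : m ≤ a + v) {τ : ℝ} (hτ : τ = x ^ (-(a / (2 * d)))) :
    A * (τ ^ 2 * (x * τ ^ 2) ^ (-(v / Δ))) + B * (x * τ ^ 2) ^ (-(m / Δ)) ≤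
      (A + B) * (x ^ (-(m / (2 * d)))) ^ 2 := by
  have hx₀ : 0 < x := zero_lt_one.trans_le hx
  have hsq : ∀ y, (x ^ (-(y / (2 * d)))) ^ 2 = x ^ (-(y / d)) := fun y => by
    rw [← Real.rpow_mul_natCast hx₀.le]
    congr 1
    field_simp
    simp
  have hscale : x * τ ^ 2 = x ^ (Δ / d) := by
    rw [hτ, hsq, mul_comm, ← Real.rpow_add_one hx₀.ne']
    congr 1
    rw [eq_div_iff hd₀.ne', add_mul, neg_mul, div_mul_cancel₀ _ hd₀.ne']
    linarith
  have hpow : ∀ y, (x * τ ^ 2) ^ (-(y / Δ)) = x ^ (-(y / d)) := fun y => by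
    rw [hscale, ← Real.rpow_mul hx₀.le]
    congr 1
    field_simp
  rw [hpow, hpow, hτ, hsq, hsq, ← Real.rpow_add hx₀, add_mul]
  gcongr
  rw [← neg_add, neg_le_neg_iff, ← add_div]
  gcongr

theorem posteriorContracts_rpow (hκ : ∀ k, 0 < κ k) (hφ : ∀ k, C₀ (φ k) = κ k • φ k)
    (hμ : IsCenteredGaussian μ C₀) (hR : Function.Injective R)
    (hP : IsCenteredGaussianSeq P φ (R ∘L R.adjoint)) {s₀ e : ℝ} (hs₀ : 0 ≤ s₀) (hs₁ : s₀ < 1)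
    (htrace : ∀ s, s₀ < s → Summable fun k => κ k ^ s) (hΔ : s₀ < Δ)
    (hfwd : ∃ c > 0, ∀ u, MemScale φ κ (1 - Δ) u →
      ∃ w, R w = K u ∧ scaleNorm φ κ (1 - Δ) u ≤ c * ‖w‖)
    (hγ : γ ∈ Set.Icc 1 (Δ + 1)) (hu' : MemScale φ κ γ u') (he : s₀ < e) :
    PosteriorContracts φ K μ P u'
      (fun n => (n : ℝ) ^ (-((γ - 1 + e) / (2 * (Δ + γ - 1 + e)))))
      (fun n => (n : ℝ) ^ (-((min 1 Δ + γ - 1) / (2 * (Δ + γ - 1 + e))))) := by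
  have hγ₁ := hγ.1
  have hΔ₀ : 0 < Δ := hs₀.trans_lt hΔ
  have hq : min 1 Δ ∈ Set.Icc 0 1 := ⟨le_min zero_le_one hΔ₀.le, min_le_left 1 Δ⟩
  have hqΔ : min 1 Δ ≤ Δ := min_le_right 1 Δ
  have hv : max 0 (min 1 Δ - e) ∈ Set.Icc 0 Δ :=
    ⟨le_max_left _ _, max_le hΔ₀.le (by linarith)⟩
  have hv₁ : max 0 (min 1 Δ - e) < 1 - s₀ := max_lt (by linarith) (by linarith [hq.2])
  obtain ⟨A, hA, B, hmse⟩ := exists_meanSquareError_le hκ hφ hμ hR hP hΔ₀ (htrace Δ hΔ) hfwd hq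
    hqΔ hv (htrace _ (by linarith)) hγ hu'
  refine posteriorContracts_of_meanSquareError_le (A := A + B) (fun n hn => by positivity)
    fun n hn => ?_
  have hn₁ : (1 : ℝ) ≤ n := by exact_mod_cast Nat.one_le_iff_ne_zero.2 hn
  refine (hmse n hn _ (Real.rpow_pos_of_pos (zero_lt_one.trans_le hn₁) _)).trans
    (ENNReal.ofReal_le_ofReal ?_)
  refine mul_rpow_add_mul_rpow_le B hn₁ hA hΔ₀.ne' (by ring) (by linarith) ?_ rfl
  linarith [le_max_right 0 (min 1 Δ - e)]

theorem min_one_add_sub_one (Δ γ : ℝ) :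
    min 1 Δ + γ - 1 = if 1 ≤ Δ then γ else Δ + γ - 1 := by
  split_ifs with h
  · rw [min_eq_left h, add_sub_cancel_left]
  · rw [min_eq_right (not_le.1 h).le]

end Rates

section SquareRoot

variable {X : Type*} [NormedAddCommGroup X] [InnerProductSpace ℝ X] [CompleteSpace X]
  {R C : X →L[ℝ] X}

theorem IsPosSqrt.comp_adjoint (hR : IsPosSqrt R C) : R ∘L R.adjoint = C := by
  rw [hR.isPositive.isSelfAdjoint.adjoint_eq, hR.comp_self]

theorem IsPosSqrt.injective (hR : IsPosSqrt R C) (hC : IsPosDef C) : Function.Injective R := by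
  refine (injective_iff_map_eq_zero R).2 fun x hx => by_contra fun hne => ?_
  have := hC.pos x hne
  rw [← hR.comp_self, ContinuousLinearMap.comp_apply, hx, map_zero, inner_zero_left] at this
  exact this.false

end SquareRoot

end LinInv

theorem theorem2p3_general {X H : Type*} [NormedAddCommGroup X] [InnerProductSpace ℝ X]
    [CompleteSpace X] [SecondCountableTopology X] [MeasurableSpace X] [BorelSpace X]
    [NormedAddCommGroup H] [InnerProductSpace ℝ H] [CompleteSpace H]
    (C₀ K : X →L[ℝ] X) (R : H →L[ℝ] X) (φ : HilbertBasis ℕ ℝ X) (κ : ℕ → ℝ)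
    (hκ : ∀ k, 0 < κ k) (hφ : ∀ k, C₀ (φ k) = κ k • φ k) (hR : Function.Injective R)
    (μ : Measure X) [IsProbabilityMeasure μ] (hμ : LinInv.IsCenteredGaussian μ C₀)
    (P : Measure (ℕ → ℝ)) [IsProbabilityMeasure P]
    (hP : LinInv.IsCenteredGaussianSeq P φ (R ∘L R.adjoint))
    (s₀ : ℝ) (hs₀ : 0 ≤ s₀) (hs₁ : s₀ < 1) (htrace : ∀ s, s₀ < s → Summable fun k => κ k ^ s)
    (Δ : ℝ) (hΔ : s₀ < Δ)
    (hfwd : ∃ c > 0, ∀ u, LinInv.MemScale φ κ (1 - Δ) u →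
      ∃ w, R w = K u ∧ LinInv.scaleNorm φ κ (1 - Δ) u ≤ c * ‖w‖)
    (γ : ℝ) (hγ : 1 ≤ γ) (u' : X) (hu' : LinInv.MemScale φ κ γ u') (ε : ℝ) (hε : 0 < ε) :
    (γ ≤ Δ + 1 →
      LinInv.PosteriorContracts φ K μ P u'
        (fun n => (n : ℝ) ^ (-((γ - 1 + s₀ + ε) / (2 * (Δ + γ - 1 + s₀ + ε)))))
        (fun n => if 1 ≤ Δ
          then (n : ℝ) ^ (-(γ / (2 * (Δ + γ - 1 + s₀ + ε))))
          else (n : ℝ) ^ (-((Δ + γ - 1) / (2 * (Δ + γ - 1 + s₀ + ε)))))) ∧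
    (Δ + 1 < γ →
      LinInv.PosteriorContracts φ K μ P u'
        (fun n => (n : ℝ) ^ (-((Δ + s₀ + ε) / (2 * (2 * Δ + s₀ + ε)))))
        (fun n => if 1 ≤ Δ
          then (n : ℝ) ^ (-((Δ + 1) / (2 * (2 * Δ + s₀ + ε))))
          else (n : ℝ) ^ (-(Δ / (2 * Δ + s₀ + ε))))) := by
  have contracts := fun {γ' : ℝ} (hγ' : γ' ∈ Set.Icc 1 (Δ + 1)) (h : LinInv.MemScale φ κ γ' u') =>
    LinInv.posteriorContracts_rpow hκ hφ hμ hR hP hs₀ hs₁ htrace hΔ hfwd hγ' h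
      (lt_add_of_pos_right s₀ hε)
  refine ⟨fun hγΔ => ?_, fun hγΔ => ?_⟩
  · convert contracts ⟨hγ, hγΔ⟩ hu' using 3 with n n
    · simp only [add_assoc]
    · rw [LinInv.min_one_add_sub_one]
      split_ifs <;> simp only [add_assoc]
  · have hu'' := hu'.mono hκ (LinInv.eigenvalue_le_opNorm hφ) hγΔ.le
    have hd : Δ + (Δ + 1) - 1 + (s₀ + ε) = 2 * Δ + s₀ + ε := by ring
    convert contracts ⟨by linarith, le_rfl⟩ hu'' using 3 with n n
    · rw [hd, add_sub_cancel_right, add_assoc]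
    · rw [hd, LinInv.min_one_add_sub_one]
      split_ifs
      · rfl
      · rw [← add_assoc, add_sub_cancel_right, ← two_mul, mul_div_mul_left _ _ two_ne_zero]

theorem theorem2p3 {X : Type*} [NormedAddCommGroup X] [InnerProductSpace ℝ X] [CompleteSpace X]
    [SecondCountableTopology X] [MeasurableSpace X] [BorelSpace X]
    (C₀ C₁ R K : X →L[ℝ] X) (A : X →ₗ.[ℝ] X) (φ : HilbertBasis ℕ ℝ X) (κ : ℕ → ℝ)
    (hC₀ : LinInv.IsPosDef C₀) (hφ : ∀ k, C₀ (φ k) = κ k • φ k)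
    (hC₁ : LinInv.IsPosDef C₁) (hR : LinInv.IsPosSqrt R C₁)
    (hA : LinInv.IsPosDefWithInverse A K)
    (s₀ β ℓ : ℝ) (hS : LinInv.ScaleAssumptions φ κ C₁ R K s₀ β ℓ)
    (μ : Measure X) [IsProbabilityMeasure μ] (hμ : LinInv.IsCenteredGaussian μ C₀)
    (P : Measure (ℕ → ℝ)) [IsProbabilityMeasure P] (hP : LinInv.IsCenteredGaussianSeq P φ C₁)
    (Δ : ℝ) (hΔ : Δ = 2 * ℓ - β + 1)
    (γ : ℝ) (hγ : 1 ≤ γ) (u' : X) (hu' : LinInv.MemScale φ κ γ u')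
    (ε : ℝ) (hε : 0 < ε) :
    (γ ≤ Δ + 1 →
      LinInv.PosteriorContracts φ K μ P u'
        (fun n => (n : ℝ) ^ (-((γ - 1 + s₀ + ε) / (2 * (Δ + γ - 1 + s₀ + ε)))))
        (fun n => if β - 2 * ℓ ≤ 0
          then (n : ℝ) ^ (-(γ / (2 * (Δ + γ - 1 + s₀ + ε))))
          else (n : ℝ) ^ (-((Δ + γ - 1) / (2 * (Δ + γ - 1 + s₀ + ε)))))) ∧
    (Δ + 1 < γ →
      LinInv.PosteriorContracts φ K μ P u'
        (fun n => (n : ℝ) ^ (-((Δ + s₀ + ε) / (2 * (2 * Δ + s₀ + ε)))))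
        (fun n => if β - 2 * ℓ ≤ 0
          then (n : ℝ) ^ (-((Δ + 1) / (2 * (2 * Δ + s₀ + ε))))
          else (n : ℝ) ^ (-(Δ / (2 * Δ + s₀ + ε))))) := by
  have hord : β - 2 * ℓ = 1 - Δ := by rw [hΔ]; ring
  obtain ⟨_, _, c, hc, hfwd⟩ := hord ▸ hS.equiv_forward
  simp only [hord, sub_nonpos]
  exact theorem2p3_general C₀ K R φ κ (hC₀.eigenvalue_pos hφ) hφ (hR.injective hC₁) μ hμ P
    (hR.comp_adjoint.symm ▸ hP) s₀ hS.s₀_nonneg hS.s₀_lt_one hS.traceClass Δ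
    (by linarith [hS.illPosed, hS.s₀_nonneg])
    ⟨c, hc, fun u hu => (hfwd u hu).imp fun _ h => ⟨h.1, h.2.2⟩⟩ γ hγ u' hu' ε hε
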